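/- Let $0<\mu<7/2$, $M>0$, $J>0$ and let $K_{1,1}>0$ be any constant. Put $p=\frac{2\mu+5}{2\mu+3}$ and let $\mathcal F_M^\mu$ be the set of all $\rho\in L^1(\mathbb R^3)\cap L^{p}(\mathbb R^3)$ with $\rho\ge 0$ almost everywhere and $\|\rho\|_{L^1(\mathbb R^3)}=M$. For $\rho\in\mathcal F_M^\mu$ define $$\mathcal E_J^\mu(\rho)=\frac{K_{1,1}}{J^{2(\mu+1)/3}}\Big(\int_{\mathbb R^3}\rho^{p}\,dx\Big)^{\frac{2\mu+3}{3}}-\frac12\iint_{\mathbb R^3\times\mathbb R^3}\frac{\rho(x)\rho(y)}{|x-y|}\,dx\,dy,\qquad R_{M,J}^\mu=\inf_{\rho\in\mathcal F_M^\mu}\mathcal E_J^\mu(\rho).$$ Then the double integral is finite for every $\rho\in\mathcal F_M^\mu$ and $-\infty<R_{M,J}^\mu<0$, so that $$R_0:=\frac{M^2}{-k\,R_{M,J}^\mu},\qquad k:=\frac73-\frac{2\mu}{3},$$ is a well-defined positive number, and the following hold. (a) If $\rho\in\mathcal F_M^\mu$ is spherically symmetric (that is, almost everywhere equal to a function of $|x|$),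 $R'>0$ and $m:=\int_{|x|\ge R'}\rho(x)\,dx$, then $$\mathcal E_J^\mu(\rho)\ \ge\ R_{M,J}^\mu+m(M-m)\Big[\frac1{R_0}-\frac1{R'}\Big].$$ (b) If $R'>R_0$, then for every sequence $(\rho_n)\subset\mathcal F_M^\mu$ of spherically symmetric functions with $\mathcal E_J^\mu(\rho_n)\to R_{M,J}^\mu$ one has $$\lim_{n\to\infty}\int_{|x|\ge R'}\rho_n(x)\,dx=0.$$ -/

import Mathlib

open MeasureTheory Filter Topology

noncomputable section

namespace StellarDynamics

/-- Euclidean `n`-space (with the Euclidean norm and Lebesgue measure). -/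
abbrev Space (n : ℕ) : Type := EuclideanSpace ℝ (Fin n)

/-- `L_+^p(ℝⁿ, M)`: the a.e. nonnegative functions in `L^p(ℝⁿ)` whose `L^p` norm is `M`. -/
def LpPlus (n : ℕ) (p : ENNReal) (M : ℝ) : Set (Space n → ℝ) :=
  {f | MemLp f p volume ∧ (∀ᵐ x ∂volume, 0 ≤ f x) ∧ (eLpNorm f p volume).toReal = M}

/-- The exponent `(2μ + 5) / (2μ + 3)`. -/
def densityExponent (μ : ℝ) : ℝ := (2 * μ + 5) / (2 * μ + 3)

/-- The constraint set `F_M^μ = L_+^1(ℝ³, M) ∩ L^{(2μ+5)/(2μ+3)}(ℝ³)`. -/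
def constraintSet (μ M : ℝ) : Set (Space 3 → ℝ) :=
  LpPlus 3 1 M ∩ {ρ | MemLp ρ (ENNReal.ofReal (densityExponent μ)) volume}

/-- The potential energy `-1/2 ∬ ρ(x) ρ(y) / |x - y| dx dy`. -/
def potentialEnergy (ρ : Space 3 → ℝ) : ℝ :=
  -(1 / 2) * ∫ z : Space 3 × Space 3, ρ z.1 * ρ z.2 / ‖z.1 - z.2‖

/-- The reduced energy
`E_J^μ(ρ) = K₁₁ / J^{2(μ+1)/3} (∫ ρ^{(2μ+5)/(2μ+3)} dx)^{(2μ+3)/3} + E_pot(ρ)`. -/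
def reducedEnergy (μ K₁₁ J : ℝ) (ρ : Space 3 → ℝ) : ℝ :=
  K₁₁ / J ^ (2 * (μ + 1) / 3) *
      (∫ x : Space 3, ρ x ^ densityExponent μ) ^ ((2 * μ + 3) / 3)
    + potentialEnergy ρ

/-- The infimum `R_{M,J}^μ` of the reduced energy over the constraint set. -/
def reducedInf (μ K₁₁ M J : ℝ) : ℝ :=
  sInf (reducedEnergy μ K₁₁ J '' constraintSet μ M)

/-- The radius `R₀ = M² / (-k R_{M,J}^μ)` with `k = 7/3 - 2μ/3`. -/
def criticalRadius (μ K₁₁ M J : ℝ) : ℝ :=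
  M ^ 2 / (-((7 / 3 - 2 * μ / 3) * reducedInf μ K₁₁ M J))

/-- Spherical symmetry (for functions up to equality a.e.): `ρ(x)` depends only on `|x|`. -/
def SphericallySymmetric (ρ : Space 3 → ℝ) : Prop :=
  ∃ g : ℝ → ℝ, ∀ᵐ x ∂volume, ρ x = g ‖x‖

/-- The mass outside the ball of radius `r`: the integral of `ρ` over `{|x| ≥ r}`. -/
def outerMass (r : ℝ) (ρ : Space 3 → ℝ) : ℝ :=
  ∫ x in {x : Space 3 | r ≤ ‖x‖}, ρ x

/-- A minimizing sequence of the reduced energy in the constraint set. -/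
def IsMinimizingSequence (μ K₁₁ M J : ℝ) (ρ : ℕ → Space 3 → ℝ) : Prop :=
  (∀ n, ρ n ∈ constraintSet μ M) ∧
    Tendsto (fun n => reducedEnergy μ K₁₁ J (ρ n)) atTop (𝓝 (reducedInf μ K₁₁ M J))

end StellarDynamics

end

noncomputable section

namespace StellarDynamics

open scoped ENNReal

/-! Write the energy as `T - D/2`, with `T` the kinetic term and `D` the interaction, and put `r =
-reducedInf`. Rescaling a density of mass `m` to mass `M` leaves a free dilation parameter `b`, in
which the energy is quadratic. Its staying above `-r` for all `b` is a discriminant condition,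
`(D/2)² ≤ 4 r (m/M)^k T` (`interaction_sq_le`). Finiteness of `D` and of `r` rests on a pointwise
Young inequality that works for `p > 6/5`, that is `μ < 7/2`; the best dilation of any density with
`D > 0` shows `r > 0`.

For (a), cut `ρ` at the sphere of radius `R'`. Let `x` be the inner share of the mass and `y` the
inner share of `∫ ρ^p`. The two self-energies add up to at most `2 √(rT) s`, where `s = x^(k/2)
y^(q/2) + (1-x)^(k/2) (1-y)^(q/2)` and `q = (2μ+3)/3`, and minimising over `T` leaves `-r s²`. By
`sq_split_le`, `s² ≤ 1 - k x (1-x)`, a gain of `k r m (M-m) / M² = m (M-m) / R₀`. The cross term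
costs at most `m (M-m) / R'`, because the potential of a radial mass is largest at the origin, where
the outer part produces at most `m / R'`.

For (b), the estimate forces `m (M-m) → 0`, and it remains to exclude `m → M` (`inner_mass_ge`).
Near the infimum `T` is close to `r`, so the potential energy must be close to `-2r`. With little
mass inside, the inner self-energy is at most about `2r/3`, and everything else is at most `M²/(2R')
≤ k r/2 < 7r/6`, which is too little. -/

/-! ### Elementary inequalities for a splitting of the mass. -/

lemma add_mul_sq_le (a b c d : ℝ) :
    (a * c + b * d) ^ 2 ≤ (a ^ 2 + b ^ 2) * (c ^ 2 + d ^ 2) := by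
  nlinarith [sq_nonneg (a * d - b * c)]

lemma rpow_add_rpow_one_sub_le_one {y r : ℝ} (hy₀ : 0 ≤ y) (hy₁ : y ≤ 1) (hr : 1 ≤ r) :
    y ^ r + (1 - y) ^ r ≤ 1 := by
  have h1 := Real.rpow_le_rpow_of_exponent_ge_of_imp hy₀ hy₁ hr (by intro _ h; linarith)
  have h2 := Real.rpow_le_rpow_of_exponent_ge_of_imp (x := 1 - y) (by linarith) (by linarith) hr
    (by intro _ h; linarith)
  rw [Real.rpow_one] at h1 h2
  linarith

/-- Equality holds at `k = 2` and `k = 3`. In between, weighted AM-GM bounds `u^k` by the linear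
interpolation of `u²` and `u³`, and the right-hand side is linear in `k`. -/
lemma rpow_add_rpow_one_sub_le {x k : ℝ} (hx₀ : 0 ≤ x) (hx₁ : x ≤ 1) (hk₂ : 2 ≤ k) (hk₃ : k ≤ 3) :
    x ^ k + (1 - x) ^ k ≤ 1 - k * (x * (1 - x)) := by
  have key : ∀ u : ℝ, 0 ≤ u → u ^ k ≤ (3 - k) * u ^ 2 + (k - 2) * u ^ 3 := by
    intro u hu
    have h := Real.geom_mean_le_arith_mean2_weighted (w₁ := 3 - k) (w₂ := k - 2) (p₁ := u ^ (2 : ℝ))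
      (p₂ := u ^ (3 : ℝ)) (by linarith) (by linarith) (by positivity) (by positivity) (by ring)
    rw [← Real.rpow_mul hu, ← Real.rpow_mul hu] at h
    rcases hu.eq_or_lt with rfl | hu'
    · rw [Real.zero_rpow (by linarith)]; simp
    · rw [← Real.rpow_add hu', show 2 * (3 - k) + 3 * (k - 2) = k by ring] at h
      exact_mod_cast h
  have h1 := key x hx₀
  have h2 := key (1 - x) (by linarith)
  nlinarith

/-- Cauchy-Schwarz separates `x` from `y`; for `q ≥ 1` the factor in `y` is at most `1`. -/
lemma sq_split_le_of_two_le {x y k q : ℝ} (hx₀ : 0 ≤ x) (hx₁ : x ≤ 1) (hy₀ : 0 ≤ y) (hy₁ : y ≤ 1)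
    (hk₂ : 2 ≤ k) (hk₃ : k ≤ 3) (hq : 1 ≤ q) :
    (x ^ (k / 2) * y ^ (q / 2) + (1 - x) ^ (k / 2) * (1 - y) ^ (q / 2)) ^ 2 ≤
      1 - k * (x * (1 - x)) := by
  have hx' : 0 ≤ 1 - x := by linarith
  have hy' : 0 ≤ 1 - y := by linarith
  have sq : ∀ (u r : ℝ), 0 ≤ u → (u ^ (r / 2)) ^ 2 = u ^ r := by
    intro u r hu
    rw [← Real.rpow_natCast, ← Real.rpow_mul hu]; congr 1; push_cast; ring
  refine (add_mul_sq_le _ _ _ _).trans ?_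
  rw [sq x k hx₀, sq _ k hx', sq y q hy₀, sq _ q hy']
  have h1 := rpow_add_rpow_one_sub_le hx₀ hx₁ hk₂ hk₃
  have h2 := rpow_add_rpow_one_sub_le_one hy₀ hy₁ hq
  have h3 : 0 ≤ x ^ k + (1 - x) ^ k := by positivity
  nlinarith

/-- For `k < 2` the factor `x^k + (1-x)^k` alone is too large, so Cauchy-Schwarz is applied only at
the endpoint `k = 2`, `q = 4/3`. On the line `k + q = 10/3`, AM-GM interpolates between it and `k =
0`, `q = 10/3`, and convexity of the square transfers the bound. -/
lemma sq_split_le_of_le_two {x y k q : ℝ} (hx₀ : 0 ≤ x) (hx₁ : x ≤ 1) (hy₀ : 0 ≤ y) (hy₁ : y ≤ 1)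
    (hk₀ : 0 < k) (hk₂ : k ≤ 2) (hkq : k + q = 10 / 3) :
    (x ^ (k / 2) * y ^ (q / 2) + (1 - x) ^ (k / 2) * (1 - y) ^ (q / 2)) ^ 2 ≤
      1 - k * (x * (1 - x)) := by
  have hx' : 0 ≤ 1 - x := by linarith
  have hy' : 0 ≤ 1 - y := by linarith
  have hq : q / 2 = 5 / 3 - k / 2 := by linarith
  have amgm : ∀ u v : ℝ, 0 ≤ u → 0 ≤ v → u ^ (k / 2) * v ^ (q / 2) ≤
      (k / 2) * (u * v ^ (2 / 3 : ℝ)) + (1 - k / 2) * v ^ (5 / 3 : ℝ) := by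
    intro u v hu hv
    have h := Real.geom_mean_le_arith_mean2_weighted (w₁ := k / 2) (w₂ := 1 - k / 2)
      (p₁ := u * v ^ (2 / 3 : ℝ)) (p₂ := v ^ (5 / 3 : ℝ)) (by linarith) (by linarith)
      (by positivity) (by positivity) (by ring)
    rw [Real.mul_rpow hu (by positivity), ← Real.rpow_mul hv, ← Real.rpow_mul hv] at h
    rcases hv.eq_or_lt with rfl | hv'
    · rw [Real.zero_rpow (by linarith), Real.zero_rpow (by norm_num), Real.zero_rpow (by norm_num)]
      simp
    · rw [mul_assoc, ← Real.rpow_add hv',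
        show 2 / 3 * (k / 2) + 5 / 3 * (1 - k / 2) = q / 2 by rw [hq]; ring] at h
      exact h
  have h1 := amgm x y hx₀ hy₀
  have h2 := amgm (1 - x) (1 - y) hx' hy'
  have hb := rpow_add_rpow_one_sub_le_one hy₀ hy₁ (r := 5 / 3) (by norm_num)
  have ha := add_mul_sq_le x (1 - x) (y ^ (2 / 3 : ℝ)) ((1 - y) ^ (2 / 3 : ℝ))
  have hc := rpow_add_rpow_one_sub_le_one hy₀ hy₁ (r := 4 / 3) (by norm_num)
  have sq : ∀ (u : ℝ), 0 ≤ u → (u ^ (2 / 3 : ℝ)) ^ 2 = u ^ (4 / 3 : ℝ) := by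
    intro u hu
    rw [← Real.rpow_natCast, ← Real.rpow_mul hu]; norm_num
  rw [sq y hy₀, sq _ hy'] at ha
  set a := x * y ^ (2 / 3 : ℝ) + (1 - x) * (1 - y) ^ (2 / 3 : ℝ) with ha_def
  have ha₀ : 0 ≤ a := by positivity
  have ha₂ : a ^ 2 ≤ 1 - 2 * (x * (1 - x)) := by
    refine ha.trans ?_
    nlinarith [sq_nonneg x, sq_nonneg (1 - x)]
  have hS : x ^ (k / 2) * y ^ (q / 2) + (1 - x) ^ (k / 2) * (1 - y) ^ (q / 2) ≤
      k / 2 * a + (1 - k / 2) := by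
    rw [ha_def]
    nlinarith
  have hS₀ : 0 ≤ x ^ (k / 2) * y ^ (q / 2) + (1 - x) ^ (k / 2) * (1 - y) ^ (q / 2) := by positivity
  calc _ ≤ (k / 2 * a + (1 - k / 2)) ^ 2 := by gcongr
    _ ≤ k / 2 * a ^ 2 + (1 - k / 2) := by
      nlinarith [mul_nonneg (mul_nonneg (by linarith : 0 ≤ k / 2) (by linarith : 0 ≤ 1 - k / 2))
        (sq_nonneg (a - 1))]
    _ ≤ _ := by nlinarith

/-- The inequality behind the strict gain of energy in a splitting of the mass. -/
lemma sq_split_le {x y k q : ℝ} (hx₀ : 0 ≤ x) (hx₁ : x ≤ 1) (hy₀ : 0 ≤ y) (hy₁ : y ≤ 1)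
    (hk₀ : 0 < k) (hk₃ : k ≤ 7 / 3) (hkq : k + q = 10 / 3) :
    (x ^ (k / 2) * y ^ (q / 2) + (1 - x) ^ (k / 2) * (1 - y) ^ (q / 2)) ^ 2 ≤
      1 - k * (x * (1 - x)) := by
  rcases le_total k 2 with h | h
  · exact sq_split_le_of_le_two hx₀ hx₁ hy₀ hy₁ hk₀ h hkq
  · exact sq_split_le_of_two_le hx₀ hx₁ hy₀ hy₁ h (by linarith) (by linarith)

/-! ### Finiteness of the Newtonian interaction. -/

/-- Integrable a.e. nonnegative densities with integrable `p`-th power. -/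
structure Admissible (p : ℝ) (ρ : Space 3 → ℝ) : Prop where
  integrable : Integrable ρ
  nonneg : ∀ᵐ x, 0 ≤ ρ x
  integrable_rpow : Integrable (fun x => ρ x ^ p)

lemma mem_constraintSet_iff {μ M : ℝ} (hμ : 0 < densityExponent μ) {ρ : Space 3 → ℝ} :
    ρ ∈ constraintSet μ M ↔ Admissible (densityExponent μ) ρ ∧ ∫ x, ρ x = M := by
  have hp0 : ENNReal.ofReal (densityExponent μ) ≠ 0 := by simpa using hμ
  have key : ∀ (h : Integrable ρ) (h0 : ∀ᵐ x, 0 ≤ ρ x),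
      ((eLpNorm ρ 1 volume).toReal = M ↔ ∫ x, ρ x = M) ∧
      (MemLp ρ (ENNReal.ofReal (densityExponent μ)) ↔
        Integrable (fun x => ρ x ^ densityExponent μ)) := by
    intro h h0
    constructor
    · rw [eLpNorm_one_eq_lintegral_enorm, ← integral_norm_eq_lintegral_enorm h.1]
      rw [integral_congr_ae (g := ρ)]
      filter_upwards [h0] with x hx using by simp [abs_of_nonneg hx]
    · rw [← integrable_norm_rpow_iff h.1 hp0 ENNReal.ofReal_ne_top,
        ENNReal.toReal_ofReal hμ.le]
      apply integrable_congr
      filter_upwards [h0] with x hx using by simp [abs_of_nonneg hx]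
  constructor
  · rintro ⟨⟨h1, h0, hM⟩, hp⟩
    rw [memLp_one_iff_integrable] at h1
    exact ⟨⟨h1, h0, (key h1 h0).2.1 hp⟩, (key h1 h0).1.1 hM⟩
  · rintro ⟨⟨h1, h0, hp⟩, hM⟩
    exact ⟨⟨memLp_one_iff_integrable.2 h1, h0, (key h1 h0).1.2 hM⟩, (key h1 h0).2.2 hp⟩

/-- The short-range part of the Newtonian kernel, raised to the power `s`. -/
def truncatedKernel (s : ℝ) (z : Space 3) : ℝ :=
  (Metric.ball (0 : Space 3) 1).indicator (fun z => ‖z‖ ^ (-s)) z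

lemma truncatedKernel_nonneg (s : ℝ) (z : Space 3) : 0 ≤ truncatedKernel s z :=
  Set.indicator_nonneg (fun _ _ => by positivity) _

lemma integrable_truncatedKernel {s : ℝ} (hs : s < 3) : Integrable (truncatedKernel s) := by
  unfold truncatedKernel
  rw [integrable_indicator_iff measurableSet_ball,
    integrableOn_fun_norm_addHaar volume (f := fun r => r ^ (-s))]
  have : IntegrableOn (fun y : ℝ => y ^ (2 - s)) (Set.Ioo 0 1) := by
    rw [intervalIntegral.integrableOn_Ioo_rpow_iff (by norm_num)]
    linarith
  refine this.congr_fun (fun y hy => ?_) measurableSet_Ioo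
  simp only [finrank_euclideanSpace, Fintype.card_fin, smul_eq_mul]
  rw [← Real.rpow_natCast, ← Real.rpow_add hy.1]
  norm_num [sub_eq_add_neg]

/-- Far from the origin `1/‖z‖ ≤ 1`. Near it, three-term AM-GM with weights `2/p - 1`, `1 - 1/p`, `1
- 1/p` splits the product; the relation on `s` makes the two kernel factors multiply to `1/‖z‖`.
Each resulting term has a product or convolution structure that integrates. -/
lemma mul_div_le_truncatedKernel {p s a b : ℝ} (hp₁ : 1 < p) (hp₂ : p < 2)
    (hs : s * (2 - 2 / p) = 1) (ha : 0 ≤ a) (hb : 0 ≤ b) (z : Space 3) :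
    a * b / ‖z‖ ≤
      a * b + a ^ p * b ^ p + (a ^ p * truncatedKernel s z + b ^ p * truncatedKernel s z) := by
  have hp0 : 0 < p := by linarith
  have hs0 : 0 < s := by
    have : 0 < 2 - 2 / p := by
      rw [sub_pos, div_lt_iff₀ hp0]; linarith
    by_contra h
    nlinarith
  have hk := truncatedKernel_nonneg s z
  have h4 : 0 ≤ a ^ p * b ^ p := by positivity
  have h5 : 0 ≤ a ^ p * truncatedKernel s z := by positivity
  have h6 : 0 ≤ b ^ p * truncatedKernel s z := by positivity
  have h7 : 0 ≤ a * b := by positivity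
  by_cases hz : 1 ≤ ‖z‖
  · have : a * b / ‖z‖ ≤ a * b := div_le_self h7 hz
    linarith
  have hzb : z ∈ Metric.ball (0 : Space 3) 1 := by simpa using hz
  rcases eq_or_ne z 0 with rfl | hz0
  · simp; linarith
  have hzp : 0 < ‖z‖ := norm_pos_iff.2 hz0
  have hkz : truncatedKernel s z = ‖z‖ ^ (-s) := by simp [truncatedKernel, Set.indicator_of_mem hzb]
  rw [hkz] at h5 h6 ⊢
  have hinv : 1 / p < 1 := by rw [div_lt_one hp0]; exact hp₁
  have hinv2 : 1 < 2 / p := by rw [lt_div_iff₀ hp0]; linarith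
  have e1 : 2 / p = 2 * (1 / p) := by ring
  have h := Real.geom_mean_le_arith_mean3_weighted (w₁ := 2 / p - 1) (w₂ := 1 - 1 / p)
    (w₃ := 1 - 1 / p) (p₁ := a ^ p * b ^ p) (p₂ := a ^ p * ‖z‖ ^ (-s)) (p₃ := b ^ p * ‖z‖ ^ (-s))
    (by linarith) (by linarith) (by linarith) h4 h5 h6 (by ring)
  have hle : a * b / ‖z‖ = (a ^ p * b ^ p) ^ (2 / p - 1) * (a ^ p * ‖z‖ ^ (-s)) ^ (1 - 1 / p) *
      (b ^ p * ‖z‖ ^ (-s)) ^ (1 - 1 / p) := by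
    rw [Real.mul_rpow (by positivity) (by positivity), Real.mul_rpow (by positivity) (by positivity),
      Real.mul_rpow (by positivity) (by positivity)]
    have hc : ∀ c : ℝ, 0 ≤ c → (c ^ p) ^ (2 / p - 1) * (c ^ p) ^ (1 - 1 / p) = c := by
      intro c hc
      rcases hc.eq_or_lt with rfl | hc'
      · rw [Real.zero_rpow hp0.ne', Real.zero_rpow (by linarith), zero_mul]
      · rw [← Real.rpow_mul hc, ← Real.rpow_mul hc, ← Real.rpow_add hc']
        rw [show p * (2 / p - 1) + p * (1 - 1 / p) = 1 by field_simp; ring, Real.rpow_one]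
    have hz' : (‖z‖ ^ (-s)) ^ (1 - 1 / p) * (‖z‖ ^ (-s)) ^ (1 - 1 / p) = ‖z‖⁻¹ := by
      rw [← Real.rpow_mul hzp.le, ← Real.rpow_add hzp, ← Real.rpow_neg_one]
      congr 1
      linear_combination -hs
    rw [div_eq_mul_inv, ← hz']
    nth_rw 1 [← hc a ha, ← hc b hb]
    ring
  rw [hle]
  nlinarith

lemma ae_prod_nonneg {ρ σ : Space 3 → ℝ} (h : ∀ᵐ x, 0 ≤ ρ x) (h' : ∀ᵐ x, 0 ≤ σ x) :
    ∀ᵐ z : Space 3 × Space 3, 0 ≤ ρ z.1 ∧ 0 ≤ σ z.2 := by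
  filter_upwards [Measure.quasiMeasurePreserving_fst.ae h,
    Measure.quasiMeasurePreserving_snd.ae h'] with z h1 h2 using ⟨h1, h2⟩

lemma integrable_mul_sub {f k : Space 3 → ℝ} (hf : Integrable f) (hk : Integrable k) :
    Integrable (fun z : Space 3 × Space 3 => f z.1 * k (z.1 - z.2)) ∧
    ∫ z : Space 3 × Space 3, f z.1 * k (z.1 - z.2) = (∫ x, f x) * ∫ x, k x := by
  have hmp : MeasurePreserving (fun z : Space 3 × Space 3 => (z.1, z.1 - z.2)) volume volume := by
    exact (MeasurePreserving.id volume).skew_product (by fun_prop)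
      (Eventually.of_forall fun x => (Measure.measurePreserving_sub_left volume x).map_eq)
  have hi : Integrable (fun z : Space 3 × Space 3 => f z.1 * k z.2) := hf.mul_prod hk
  have hI := hmp.integrable_comp hi.1
  refine ⟨hI.2 hi, ?_⟩
  -- The shear `(x, y) ↦ (x, x - y)` is its own inverse.
  have he : MeasurableEmbedding (fun z : Space 3 × Space 3 => (z.1, z.1 - z.2)) := by
    refine (MeasurableEquiv.measurableEmbedding
      ⟨⟨fun z => (z.1, z.1 - z.2), fun z => (z.1, z.1 - z.2), ?_, ?_⟩, ?_, ?_⟩)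
    · intro z; simp
    · intro z; simp
    · simp only [Equiv.coe_fn_mk]; fun_prop
    · simp only [Equiv.coe_fn_symm_mk]; fun_prop
  have := hmp.integral_comp he (fun z => f z.1 * k z.2)
  rw [this]
  exact integral_prod_mul f k

lemma integrable_mul_sub' {f k : Space 3 → ℝ} (hf : Integrable f) (hk : Integrable k) :
    Integrable (fun z : Space 3 × Space 3 => f z.2 * k (z.1 - z.2)) ∧
    ∫ z : Space 3 × Space 3, f z.2 * k (z.1 - z.2) = (∫ x, f x) * ∫ x, k x := by
  obtain ⟨h1, h2⟩ := integrable_mul_sub hf hk.comp_neg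
  simp only [neg_sub] at h1 h2
  have h1' : Integrable (fun z : Space 3 × Space 3 => f z.2 * k (z.1 - z.2))
      ((volume : Measure (Space 3)).prod volume) := h1.swap
  refine ⟨h1', ?_⟩
  rw [← integral_neg_eq_self k, ← h2]
  exact integral_prod_swap (μ := volume) (ν := volume)
    (fun z : Space 3 × Space 3 => f z.1 * k (z.2 - z.1))

/-- The Newtonian interaction integrand of two densities. -/
def interactionIntegrand (ρ σ : Space 3 → ℝ) (z : Space 3 × Space 3) : ℝ :=
  ρ z.1 * σ z.2 / ‖z.1 - z.2‖

/-- The Newtonian interaction `∬ ρ(x) σ(y) / |x - y| dx dy`. -/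
def interaction (ρ σ : Space 3 → ℝ) : ℝ := ∫ z, interactionIntegrand ρ σ z

lemma aestronglyMeasurable_interactionIntegrand {ρ σ : Space 3 → ℝ}
    (hρ : AEStronglyMeasurable ρ) (hσ : AEStronglyMeasurable σ) :
    AEStronglyMeasurable (interactionIntegrand ρ σ) := by
  unfold interactionIntegrand
  refine AEStronglyMeasurable.div₀ ((hρ.comp_fst).mul (hσ.comp_snd)) ?_
  exact (by fun_prop : Measurable fun z : Space 3 × Space 3 => ‖z.1 - z.2‖).aestronglyMeasurable

lemma integrable_interaction_and_le {p s : ℝ} (hp₁ : 1 < p) (hp₂ : p < 2)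
    (hs : s * (2 - 2 / p) = 1) (hs₃ : s < 3) {ρ σ : Space 3 → ℝ} (hρ : Admissible p ρ)
    (hσ : Admissible p σ) :
    Integrable (interactionIntegrand ρ σ) ∧
    interaction ρ σ ≤ (∫ x, ρ x) * (∫ x, σ x) + (∫ x, ρ x ^ p) * (∫ x, σ x ^ p) +
      ((∫ x, ρ x ^ p) * (∫ x, truncatedKernel s x) +
        (∫ x, σ x ^ p) * (∫ x, truncatedKernel s x)) := by
  have hk := integrable_truncatedKernel hs₃
  have i1 : Integrable (fun z : Space 3 × Space 3 => ρ z.1 * σ z.2) :=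
    hρ.integrable.mul_prod hσ.integrable
  have i2 : Integrable (fun z : Space 3 × Space 3 => ρ z.1 ^ p * σ z.2 ^ p) :=
    hρ.integrable_rpow.mul_prod hσ.integrable_rpow
  have e1 : ∫ z : Space 3 × Space 3, ρ z.1 * σ z.2 = (∫ x, ρ x) * (∫ x, σ x) :=
    integral_prod_mul ρ σ
  have e2 : ∫ z : Space 3 × Space 3, ρ z.1 ^ p * σ z.2 ^ p = (∫ x, ρ x ^ p) * (∫ x, σ x ^ p) :=
    integral_prod_mul (fun x => ρ x ^ p) (fun x => σ x ^ p)
  obtain ⟨i3, e3⟩ := integrable_mul_sub hρ.integrable_rpow hk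
  obtain ⟨i4, e4⟩ := integrable_mul_sub' hσ.integrable_rpow hk
  have hle : ∀ᵐ z : Space 3 × Space 3, interactionIntegrand ρ σ z ≤
      ρ z.1 * σ z.2 + ρ z.1 ^ p * σ z.2 ^ p + (ρ z.1 ^ p * truncatedKernel s (z.1 - z.2) +
        σ z.2 ^ p * truncatedKernel s (z.1 - z.2)) := by
    filter_upwards [ae_prod_nonneg hρ.nonneg hσ.nonneg] with z hz
    exact mul_div_le_truncatedKernel hp₁ hp₂ hs hz.1 hz.2 _
  have iI := (i1.add i2).add (i3.add i4)
  have hint : Integrable (interactionIntegrand ρ σ) := by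
    refine iI.mono' (aestronglyMeasurable_interactionIntegrand hρ.integrable.1 hσ.integrable.1) ?_
    filter_upwards [hle, ae_prod_nonneg hρ.nonneg hσ.nonneg] with z hz hz0
    rw [Real.norm_of_nonneg]
    · exact hz
    · exact div_nonneg (mul_nonneg hz0.1 hz0.2) (norm_nonneg _)
  refine ⟨hint, (integral_mono_ae hint iI hle).trans_eq ?_⟩
  rw [← e1, ← e2, ← e3, ← e4, ← integral_add i1 i2, ← integral_add i3 i4]
  exact integral_add (i1.add i2) (i3.add i4)

/-- The threshold `6/5` is where the kernel exponent `s = (2 - 2/p)⁻¹` drops below the dimension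
`3`. -/
lemma integrable_interactionIntegrand {p : ℝ} (hp₁ : 6 / 5 < p) (hp₂ : p < 2)
    {ρ σ : Space 3 → ℝ} (hρ : Admissible p ρ) (hσ : Admissible p σ) :
    Integrable (interactionIntegrand ρ σ) := by
  have h : 1 / 3 < 2 - 2 / p := by
    rw [lt_sub_comm, div_lt_iff₀ (by linarith)]; linarith
  refine (integrable_interaction_and_le (s := (2 - 2 / p)⁻¹) (by linarith) hp₂
    (inv_mul_cancel₀ (by linarith)) ?_ hρ hσ).1
  rw [inv_lt_comm₀ (by linarith) (by norm_num)]
  linarith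

lemma interaction_nonneg {ρ σ : Space 3 → ℝ} (h : ∀ᵐ x, 0 ≤ ρ x) (h' : ∀ᵐ x, 0 ≤ σ x) :
    0 ≤ interaction ρ σ := by
  refine integral_nonneg_of_ae ?_
  filter_upwards [ae_prod_nonneg h h'] with z hz
  exact div_nonneg (mul_nonneg hz.1 hz.2) (norm_nonneg _)

/-! ### Behaviour under scaling. -/

/-- The rescaled density `x ↦ a ρ(b x)`. -/
def rescale (a b : ℝ) (ρ : Space 3 → ℝ) (x : Space 3) : ℝ := a * ρ (b • x)

lemma ae_comp_smul {b : ℝ} (hb : b ≠ 0) {P : Space 3 → Prop} (h : ∀ᵐ x, P x) :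
    ∀ᵐ x : Space 3, P (b • x) :=
  (Measure.quasiMeasurePreserving_smul (volume : Measure (Space 3)) hb).ae h

lemma rescale_rpow_ae_eq {p a b : ℝ} (ha : 0 < a) (hb : 0 < b) {ρ : Space 3 → ℝ}
    (h : ∀ᵐ x, 0 ≤ ρ x) :
    (fun x => rescale a b ρ x ^ p) =ᵐ[volume] fun x => a ^ p * ρ (b • x) ^ p := by
  filter_upwards [ae_comp_smul hb.ne' h] with x hx
  rw [rescale, Real.mul_rpow ha.le hx]

lemma Admissible.rescale {p a b : ℝ} (ha : 0 < a) (hb : 0 < b) {ρ : Space 3 → ℝ}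
    (h : Admissible p ρ) : Admissible p (rescale a b ρ) where
  integrable := (h.integrable.comp_smul hb.ne').const_mul a
  nonneg := by
    filter_upwards [ae_comp_smul hb.ne' h.nonneg] with x hx using mul_nonneg ha.le hx
  integrable_rpow := by
    refine Integrable.congr ?_ (rescale_rpow_ae_eq ha hb h.nonneg).symm
    exact (h.integrable_rpow.comp_smul hb.ne').const_mul _

lemma integral_rescale {a b : ℝ} (hb : 0 < b) (ρ : Space 3 → ℝ) :
    ∫ x, rescale a b ρ x = a * b⁻¹ ^ 3 * ∫ x, ρ x := by
  unfold rescale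
  rw [integral_const_mul, Measure.integral_comp_smul]
  simp only [finrank_euclideanSpace, Fintype.card_fin, smul_eq_mul]
  rw [abs_of_pos (by positivity), inv_pow, mul_assoc]

lemma integral_rescale_rpow {p a b : ℝ} (ha : 0 < a) (hb : 0 < b) {ρ : Space 3 → ℝ}
    (h : ∀ᵐ x, 0 ≤ ρ x) :
    ∫ x, rescale a b ρ x ^ p = a ^ p * b⁻¹ ^ 3 * ∫ x, ρ x ^ p := by
  rw [integral_congr_ae (rescale_rpow_ae_eq ha hb h), integral_const_mul,
    Measure.integral_comp_smul volume (fun x => ρ x ^ p)]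
  simp only [finrank_euclideanSpace, Fintype.card_fin, smul_eq_mul]
  rw [abs_of_pos (by positivity), inv_pow, mul_assoc]

/-- The kernel contributes `b` and the six-dimensional volume `b⁻¹ ^ 6`. -/
lemma interaction_rescale {a b : ℝ} (hb : 0 < b) (ρ : Space 3 → ℝ) :
    interaction (rescale a b ρ) (rescale a b ρ) = a ^ 2 * b⁻¹ ^ 5 * interaction ρ ρ := by
  have h : ∀ z, interactionIntegrand (rescale a b ρ) (rescale a b ρ) z =
      a ^ 2 * b * interactionIntegrand ρ ρ (b • z) := by
    intro z
    simp only [interactionIntegrand, rescale, Prod.smul_fst, Prod.smul_snd]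
    rw [← smul_sub, norm_smul, Real.norm_of_nonneg hb.le]
    rcases eq_or_ne ‖z.1 - z.2‖ 0 with h0 | h0
    · simp [h0]
    · field_simp
  unfold interaction
  simp_rw [h]
  have : (volume : Measure (Space 3 × Space 3)).IsAddHaarMeasure :=
    inferInstanceAs ((volume : Measure (Space 3)).prod (volume : Measure (Space 3))).IsAddHaarMeasure
  rw [integral_const_mul, Measure.integral_comp_smul volume (interactionIntegrand ρ ρ)]
  simp only [Module.finrank_prod, finrank_euclideanSpace, Fintype.card_fin, smul_eq_mul]
  rw [abs_of_pos (by positivity)]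
  field_simp

lemma Admissible.integral_rpow_pos {p : ℝ} {ρ : Space 3 → ℝ} (h : Admissible p ρ)
    (hm : 0 < ∫ x, ρ x) : 0 < ∫ x, ρ x ^ p := by
  have h0 : 0 ≤ᵐ[volume] fun x => ρ x ^ p := by
    filter_upwards [h.nonneg] with x hx using Real.rpow_nonneg hx p
  refine lt_of_le_of_ne (integral_nonneg_of_ae h0) fun he => hm.ne' ?_
  have := (integral_eq_zero_iff_of_nonneg_ae h0 h.integrable_rpow).1 he.symm
  rw [integral_eq_zero_iff_of_nonneg_ae h.nonneg h.integrable]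
  filter_upwards [this, h.nonneg] with x hx hx0
  exact ((Real.rpow_eq_zero_iff_of_nonneg hx0).1 hx).1

/-! ### The infimum of the energy and the scaling inequality. -/

section Energy

variable {μ K₁₁ M J : ℝ}

lemma densityExponent_gt (hμ₀ : 0 < μ) (hμ₁ : μ < 7 / 2) : 6 / 5 < densityExponent μ := by
  unfold densityExponent
  rw [lt_div_iff₀ (by linarith)]; linarith

lemma densityExponent_lt_two (hμ₀ : 0 < μ) : densityExponent μ < 2 := by
  unfold densityExponent
  rw [div_lt_iff₀ (by linarith)]; linarith

lemma reducedEnergy_eq (ρ : Space 3 → ℝ) :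
    reducedEnergy μ K₁₁ J ρ = K₁₁ / J ^ (2 * (μ + 1) / 3) *
      (∫ x : Space 3, ρ x ^ densityExponent μ) ^ ((2 * μ + 3) / 3) - interaction ρ ρ / 2 := by
  unfold reducedEnergy potentialEnergy interaction interactionIntegrand
  ring

/-- Rescaling a density of mass `m` to mass `M`. -/
lemma exists_rescale (hμ₀ : 0 < μ) (hM : 0 < M) {ρ : Space 3 → ℝ} {m b : ℝ}
    (hρ : Admissible (densityExponent μ) ρ) (hm : ∫ x, ρ x = m) (hm₀ : 0 < m) (hb : 0 < b) :
    ∃ σ ∈ constraintSet μ M,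
      (∫ x, σ x ^ densityExponent μ) ^ ((2 * μ + 3) / 3) = b ^ 2 * (M / m) ^ ((2 * μ + 5) / 3) *
        (∫ x, ρ x ^ densityExponent μ) ^ ((2 * μ + 3) / 3) ∧
      interaction σ σ = b * (M / m) ^ 2 * interaction ρ ρ := by
  have hp : 0 < densityExponent μ := by unfold densityExponent; positivity
  have hA := (hρ.integral_rpow_pos (hm ▸ hm₀)).le
  have ha : 0 < b ^ 3 * (M / m) := by positivity
  refine ⟨rescale (b ^ 3 * (M / m)) b ρ, ?_, ?_, ?_⟩
  · rw [mem_constraintSet_iff hp]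
    refine ⟨hρ.rescale ha hb, ?_⟩
    rw [integral_rescale hb, hm]
    field_simp
  · rw [integral_rescale_rpow ha hb hρ.nonneg, Real.mul_rpow (by positivity) hA,
      Real.mul_rpow (by positivity) (by positivity), ← Real.rpow_mul ha.le,
      show densityExponent μ * ((2 * μ + 3) / 3) = (2 * μ + 5) / 3 by
        unfold densityExponent; field_simp,
      Real.mul_rpow (by positivity) (by positivity)]
    have : (b ^ 3) ^ ((2 * μ + 5) / 3) * (b⁻¹ ^ 3) ^ ((2 * μ + 3) / 3) = b ^ 2 := by
      rw [← Real.rpow_natCast b 3, ← Real.rpow_natCast b⁻¹ 3, ← Real.rpow_mul hb.le,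
        ← Real.rpow_mul (by positivity), Real.inv_rpow hb.le, ← Real.rpow_neg hb.le,
        ← Real.rpow_add hb, ← Real.rpow_natCast b 2]
      congr 1; push_cast; ring
    rw [← this]; ring
  · rw [interaction_rescale hb]
    field_simp

lemma exists_interaction_le (hμ₀ : 0 < μ) (hμ₁ : μ < 7 / 2) (hM : 0 < M) :
    ∃ C : ℝ, ∀ ρ ∈ constraintSet μ M, interaction ρ ρ ≤
      C * (∫ x, ρ x ^ densityExponent μ) ^ ((2 * μ + 3) / 3 / 2) := by
  have hp₁ := densityExponent_gt hμ₀ hμ₁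
  have hp₂ := densityExponent_lt_two hμ₀
  have hp : 0 < densityExponent μ := by linarith
  set s := (2 - 2 / densityExponent μ)⁻¹ with hs
  have h3 : 1 / 3 < 2 - 2 / densityExponent μ := by
    rw [lt_sub_comm, div_lt_iff₀ hp]; linarith
  have hs1 : s * (2 - 2 / densityExponent μ) = 1 := inv_mul_cancel₀ (by linarith)
  have hs3 : s < 3 := by
    rw [hs, inv_lt_comm₀ (by linarith) (by norm_num)]; linarith
  refine ⟨M * M + 1 * 1 + (1 * (∫ x, truncatedKernel s x) + 1 * (∫ x, truncatedKernel s x)), ?_⟩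
  intro ρ hρ
  obtain ⟨hρ, hm⟩ := (mem_constraintSet_iff hp).1 hρ
  have hA := hρ.integral_rpow_pos (hm ▸ hM)
  set A := ∫ x, ρ x ^ densityExponent μ with hAdef
  have hw : 0 < A ^ ((2 * μ + 3) / 3 / 2) := by positivity
  -- This dilation normalises `∫ σ^p` to `1`, so the inhomogeneous bound for `σ` becomes a
  -- homogeneous one for `ρ`.
  obtain ⟨σ, hσ, h1, h2⟩ := exists_rescale (b := (A ^ ((2 * μ + 3) / 3 / 2))⁻¹) hμ₀ hM hρ hm hM
    (by positivity)
  obtain ⟨hσ, hmσ⟩ := (mem_constraintSet_iff hp).1 hσ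
  have hsq : (A ^ ((2 * μ + 3) / 3 / 2)) ^ 2 = A ^ ((2 * μ + 3) / 3) := by
    rw [← Real.rpow_natCast, ← Real.rpow_mul hA.le]; congr 1; push_cast; ring
  rw [div_self hM.ne', Real.one_rpow, mul_one, inv_pow, hsq, inv_mul_cancel₀ (by positivity)] at h1
  rw [div_self hM.ne', one_pow, mul_one] at h2
  have hA1 : ∫ x, σ x ^ densityExponent μ = 1 := by
    have hA0 := (hσ.integral_rpow_pos (hmσ ▸ hM)).le
    rwa [← Real.one_rpow ((2 * μ + 3) / 3), Real.rpow_left_inj hA0 zero_le_one (by positivity)] at h1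
  have := (integrable_interaction_and_le (by linarith) hp₂ hs1 hs3 hσ hσ).2
  rw [hmσ, hA1, h2, inv_mul_le_iff₀ hw] at this
  linarith

lemma bddBelow_reducedEnergy (hμ₀ : 0 < μ) (hμ₁ : μ < 7 / 2) (hK : 0 < K₁₁) (hM : 0 < M)
    (hJ : 0 < J) : BddBelow (reducedEnergy μ K₁₁ J '' constraintSet μ M) := by
  obtain ⟨C, hC⟩ := exists_interaction_le hμ₀ hμ₁ hM
  have hKc : 0 < K₁₁ / J ^ (2 * (μ + 1) / 3) := by positivity
  have hp := densityExponent_gt hμ₀ hμ₁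
  refine ⟨-(C ^ 2 / (16 * (K₁₁ / J ^ (2 * (μ + 1) / 3)))), ?_⟩
  rintro _ ⟨ρ, hρ, rfl⟩
  have h := hC ρ hρ
  obtain ⟨hρ, hm⟩ := (mem_constraintSet_iff (by linarith)).1 hρ
  have hA := hρ.integral_rpow_pos (hm ▸ hM)
  rw [reducedEnergy_eq]
  set A := ∫ x, ρ x ^ densityExponent μ
  set c := K₁₁ / J ^ (2 * (μ + 1) / 3)
  have hsq : A ^ ((2 * μ + 3) / 3) = (A ^ ((2 * μ + 3) / 3 / 2)) ^ 2 := by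
    rw [← Real.rpow_natCast, ← Real.rpow_mul hA.le]; congr 1; push_cast; ring
  rw [hsq]
  set w := A ^ ((2 * μ + 3) / 3 / 2)
  -- Completing the square: the energy is at least `c w² - C w / 2`, smallest at `w = C / (4c)`.
  have : -(C ^ 2 / (16 * c)) = c * w ^ 2 - C * w / 2 - (4 * c * w - C) ^ 2 / (16 * c) := by
    field_simp; ring
  have h2 : 0 ≤ (4 * c * w - C) ^ 2 / (16 * c) := by positivity
  linarith

lemma exists_mem_constraintSet_interaction_pos (hμ₀ : 0 < μ) (hμ₁ : μ < 7 / 2) (hM : 0 < M) :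
    ∃ ρ ∈ constraintSet μ M, 0 < interaction ρ ρ := by
  have hp₁ := densityExponent_gt hμ₀ hμ₁
  have hp₂ := densityExponent_lt_two hμ₀
  have hp : 0 < densityExponent μ := by linarith
  set B := Metric.ball (0 : Space 3) 1
  have hBm : MeasurableSet B := measurableSet_ball
  have hBf : volume B < ⊤ := measure_ball_lt_top
  have hB0 : 0 < volume B := Metric.measure_ball_pos _ _ one_pos
  have hBr : 0 < volume.real B := ENNReal.toReal_pos hB0.ne' hBf.ne
  set ρ := B.indicator (fun _ => M / volume.real B) with hρdef
  have hc : 0 < M / volume.real B := by positivity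
  have hρ0 : ∀ x, 0 ≤ ρ x := fun x => Set.indicator_nonneg (fun _ _ => hc.le) _
  have hadm : Admissible (densityExponent μ) ρ := by
    refine ⟨?_, Eventually.of_forall hρ0, ?_⟩
    · rw [hρdef, integrable_indicator_iff hBm]
      exact integrableOn_const hBf.ne
    · have : (fun x => ρ x ^ densityExponent μ) =
          B.indicator (fun _ => (M / volume.real B) ^ densityExponent μ) := by
        ext x
        by_cases hx : x ∈ B
        · simp [hρdef, hx]
        · simp [hρdef, hx, Real.zero_rpow hp.ne']
      rw [this, integrable_indicator_iff hBm]
      exact integrableOn_const hBf.ne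
  have hmass : ∫ x, ρ x = M := by
    rw [hρdef, integral_indicator hBm, setIntegral_const, smul_eq_mul]
    field_simp
  refine ⟨ρ, (mem_constraintSet_iff hp).2 ⟨hadm, hmass⟩, ?_⟩
  have hi := integrable_interactionIntegrand hp₁ hp₂ hadm hadm
  unfold interaction
  rw [integral_pos_iff_support_of_nonneg_ae _ hi]
  · have hsub : (B ×ˢ B) \ {z | z.1 = z.2} ⊆ Function.support (interactionIntegrand ρ ρ) := by
      rintro z ⟨⟨h1, h2⟩, h3⟩
      have h4 : z.1 - z.2 ≠ 0 := sub_ne_zero.2 h3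
      simp only [Function.mem_support, interactionIntegrand, hρdef, Set.indicator_of_mem h1,
        Set.indicator_of_mem h2]
      have := norm_pos_iff.2 h4
      positivity
    refine lt_of_lt_of_le ?_ (measure_mono hsub)
    have hdiag : volume {z : Space 3 × Space 3 | z.1 = z.2} = 0 := by
      have hms : MeasurableSet {z : Space 3 × Space 3 | z.1 = z.2} :=
        measurableSet_eq_fun measurable_fst measurable_snd
      rw [Measure.volume_eq_prod, Measure.measure_prod_null hms]
      refine Eventually.of_forall fun x => ?_
      have : Prod.mk x ⁻¹' {z : Space 3 × Space 3 | z.1 = z.2} = {x} := by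
        ext y; simp [eq_comm]
      simp [this]
    rw [measure_sdiff_null hdiag, Measure.volume_eq_prod, Measure.prod_prod]
    exact ENNReal.mul_pos hB0.ne' hB0.ne'
  · exact Eventually.of_forall fun z => div_nonneg (mul_nonneg (hρ0 _) (hρ0 _)) (norm_nonneg _)

lemma reducedInf_neg (hμ₀ : 0 < μ) (hμ₁ : μ < 7 / 2) (hK : 0 < K₁₁) (hM : 0 < M)
    (hJ : 0 < J) : reducedInf μ K₁₁ M J < 0 := by
  obtain ⟨ρ, hρ, hD⟩ := exists_mem_constraintSet_interaction_pos hμ₀ hμ₁ hM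
  have hp := densityExponent_gt hμ₀ hμ₁
  obtain ⟨hρ, hm⟩ := (mem_constraintSet_iff (by linarith)).1 hρ
  have hA := hρ.integral_rpow_pos (hm ▸ hM)
  have hc : 0 < K₁₁ / J ^ (2 * (μ + 1) / 3) := by positivity
  have hw : 0 < (∫ x, ρ x ^ densityExponent μ) ^ ((2 * μ + 3) / 3) := by positivity
  set c := K₁₁ / J ^ (2 * (μ + 1) / 3)
  set w := (∫ x, ρ x ^ densityExponent μ) ^ ((2 * μ + 3) / 3)
  -- This `b` minimises `c w b² - b D / 2`, where `D = interaction ρ ρ`.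
  obtain ⟨σ, hσ, h1, h2⟩ := exists_rescale (b := interaction ρ ρ / (4 * (c * w))) hμ₀ hM hρ hm hM
    (by positivity)
  refine (csInf_le (bddBelow_reducedEnergy hμ₀ hμ₁ hK hM hJ) ⟨σ, hσ, rfl⟩).trans_lt ?_
  rw [reducedEnergy_eq, h1, h2, div_self hM.ne', Real.one_rpow]
  have : c * ((interaction ρ ρ / (4 * (c * w))) ^ 2 * 1 * w) -
      interaction ρ ρ / (4 * (c * w)) * 1 ^ 2 * interaction ρ ρ / 2 =
      -(interaction ρ ρ ^ 2 / (16 * (c * w))) := by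
    field_simp; ring
  rw [this, neg_lt_zero]
  positivity

/-- The sharp interpolation inequality obtained from the infimum by scaling. -/
lemma interaction_sq_le (hμ₀ : 0 < μ) (hμ₁ : μ < 7 / 2) (hK : 0 < K₁₁) (hM : 0 < M)
    (hJ : 0 < J) {ρ : Space 3 → ℝ} {m : ℝ} (hρ : Admissible (densityExponent μ) ρ)
    (hm : ∫ x, ρ x = m) (hm₀ : 0 < m) :
    (interaction ρ ρ / 2) ^ 2 ≤ 4 * (-reducedInf μ K₁₁ M J) *
      ((m / M) ^ (7 / 3 - 2 * μ / 3) * (K₁₁ / J ^ (2 * (μ + 1) / 3) *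
        (∫ x, ρ x ^ densityExponent μ) ^ ((2 * μ + 3) / 3))) := by
  have hp := densityExponent_gt hμ₀ hμ₁
  have hA := hρ.integral_rpow_pos (hm ▸ hm₀)
  have hR := reducedInf_neg hμ₀ hμ₁ hK hM hJ
  have hD := interaction_nonneg hρ.nonneg hρ.nonneg
  have hinf : ∀ b : ℝ, 0 < b → reducedInf μ K₁₁ M J ≤ K₁₁ / J ^ (2 * (μ + 1) / 3) *
      (b ^ 2 * (M / m) ^ ((2 * μ + 5) / 3) *
        (∫ x, ρ x ^ densityExponent μ) ^ ((2 * μ + 3) / 3)) -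
      b * (M / m) ^ 2 * interaction ρ ρ / 2 := by
    intro b hb
    obtain ⟨σ, hσ, h1, h2⟩ := exists_rescale hμ₀ hM hρ hm hm₀ hb
    rw [← h1, ← h2, ← reducedEnergy_eq]
    exact csInf_le (bddBelow_reducedEnergy hμ₀ hμ₁ hK hM hJ) ⟨σ, hσ, rfl⟩
  have hc : 0 < K₁₁ / J ^ (2 * (μ + 1) / 3) := by positivity
  have hw : 0 < (∫ x, ρ x ^ densityExponent μ) ^ ((2 * μ + 3) / 3) := by positivity
  set c := K₁₁ / J ^ (2 * (μ + 1) / 3)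
  set w := (∫ x, ρ x ^ densityExponent μ) ^ ((2 * μ + 3) / 3)
  set R := reducedInf μ K₁₁ M J
  have hl : 0 < M / m := by positivity
  -- The quadratic in `b` is nonnegative for `b > 0` by definition of the infimum, and for `b ≤ 0`
  -- by the signs of its coefficients.
  have hdisc := discrim_le_zero (a := c * (M / m) ^ ((2 * μ + 5) / 3) * w)
    (b := -((M / m) ^ 2 * interaction ρ ρ / 2)) (c := -R) (fun b => by
      rcases le_or_gt b 0 with hb | hb
      · have h1 : 0 ≤ c * (M / m) ^ ((2 * μ + 5) / 3) * w * (b * b) :=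
          mul_nonneg (by positivity) (mul_self_nonneg b)
        have h2 : 0 ≤ (M / m) ^ 2 * interaction ρ ρ / 2 * (-b) :=
          mul_nonneg (by positivity) (by linarith)
        linarith
      · have := hinf b hb
        linarith)
  rw [discrim] at hdisc
  -- The exponent `k` arises here as `4 - (2μ + 5)/3`.
  have hk : (M / m) ^ ((2 * μ + 5) / 3) = (M / m) ^ 4 * (m / M) ^ (7 / 3 - 2 * μ / 3) := by
    rw [← inv_div M m, Real.inv_rpow hl.le, ← Real.rpow_neg hl.le, ← Real.rpow_natCast,
      ← Real.rpow_add hl]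
    congr 1; push_cast; ring
  rw [hk] at hdisc
  have h4 : 0 < (M / m) ^ 4 := by positivity
  refine le_of_mul_le_mul_left ?_ h4
  linarith

end Energy

/-! ### Axial integration and the potential of a radial density. -/

lemma lintegral_space_three {F : ℝ × ℝ × ℝ → ℝ≥0∞} (hF : Measurable F) :
    ∫⁻ y : Space 3, F (y 0, y 1, y 2) = ∫⁻ z : ℝ, ∫⁻ p : ℝ × ℝ, F (z, p) := by
  have h1 : MeasurePreserving (fun y : Space 3 => (y 0, y 1, y 2)) volume volume := by
    have e1 := PiLp.volume_preserving_ofLp (Fin 3)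
    have e2 := volume_preserving_piFinSuccAbove (fun _ : Fin 3 => ℝ) 0
    have e3 : MeasurePreserving (Prod.map id (MeasurableEquiv.finTwoArrow (α := ℝ)))
        ((volume : Measure ℝ).prod (volume : Measure (Fin 2 → ℝ)))
        ((volume : Measure ℝ).prod (volume : Measure (ℝ × ℝ))) :=
      (MeasurePreserving.id volume).prod (volume_preserving_finTwoArrow ℝ)
    exact e3.comp (e2.comp e1)
  rw [h1.lintegral_comp hF, Measure.volume_eq_prod, lintegral_prod _ hF.aemeasurable]

lemma lintegral_comp_sq_add_sq {f : ℝ → ℝ≥0∞} (hf : Measurable f) :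
    ∫⁻ p : ℝ × ℝ, f (p.1 ^ 2 + p.2 ^ 2) =
      ENNReal.ofReal (2 * Real.pi) * ∫⁻ s in Set.Ioi (0 : ℝ), ENNReal.ofReal s * f (s ^ 2) := by
  rw [← lintegral_comp_polarCoord_symm, polarCoord_target, Measure.volume_eq_prod,
    ← Measure.prod_restrict]
  have h : ∀ q : ℝ × ℝ, ENNReal.ofReal q.1 • f ((polarCoord.symm q).1 ^ 2 +
      (polarCoord.symm q).2 ^ 2) = (ENNReal.ofReal q.1 * f (q.1 ^ 2)) * (1 : ℝ≥0∞) := by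
    intro q
    rw [polarCoord_symm_apply, smul_eq_mul, mul_one]
    congr 2
    linear_combination q.1 ^ 2 * Real.sin_sq_add_cos_sq q.2
  simp_rw [h]
  rw [lintegral_prod_mul (f := fun s : ℝ => ENNReal.ofReal s * f (s ^ 2)) (g := fun _ => 1)
    (by fun_prop) (by fun_prop)]
  simp only [lintegral_const, Measure.restrict_apply_univ, Real.volume_Ioo, one_mul]
  rw [mul_comm]
  congr 2; ring

lemma lintegral_Ioi_sqrt (f : ℝ → ℝ≥0∞) (z : ℝ) :
    ∫⁻ s in Set.Ioi (0 : ℝ), ENNReal.ofReal s * f (√(z ^ 2 + s ^ 2)) =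
      ∫⁻ r in Set.Ioi |z|, ENNReal.ofReal r * f r := by
  have himg : (fun s : ℝ => √(z ^ 2 + s ^ 2)) '' Set.Ioi 0 = Set.Ioi |z| := by
    ext r
    simp only [Set.mem_image, Set.mem_Ioi]
    constructor
    · rintro ⟨s, hs, rfl⟩
      rw [← Real.sqrt_sq_eq_abs]
      exact Real.sqrt_lt_sqrt (sq_nonneg z) (by nlinarith)
    · intro hr
      have hr0 : 0 < r := (abs_nonneg z).trans_lt hr
      have hzr : 0 < r ^ 2 - z ^ 2 := by
        rw [← sq_abs z, sub_pos]; exact pow_lt_pow_left₀ hr (abs_nonneg z) two_ne_zero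
      refine ⟨√(r ^ 2 - z ^ 2), Real.sqrt_pos.2 hzr, ?_⟩
      rw [Real.sq_sqrt hzr.le, add_sub_cancel, Real.sqrt_sq hr0.le]
  have hpos : ∀ s ∈ Set.Ioi (0 : ℝ), 0 < z ^ 2 + s ^ 2 := fun s hs => by
    have : 0 < s ^ 2 := pow_pos hs 2
    positivity
  rw [← himg, lintegral_image_eq_lintegral_abs_deriv_mul measurableSet_Ioi
    (f' := fun s => s / √(z ^ 2 + s ^ 2))]
  · refine setLIntegral_congr_fun measurableSet_Ioi fun s hs => ?_
    have hs0 : 0 < s := hs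
    have hq := Real.sqrt_pos.2 (hpos s hs)
    rw [abs_of_pos (by positivity), ← mul_assoc, ← ENNReal.ofReal_mul (by positivity),
      div_mul_cancel₀ _ hq.ne']
  · intro s hs
    have h := (((hasDerivAt_id s).pow 2).const_add (z ^ 2)).sqrt (hpos s hs).ne'
    refine (h.congr_deriv ?_).hasDerivWithinAt
    simp
    ring
  · intro s hs s' hs' h
    have hs0 : 0 < s := hs
    have hs0' : 0 < s' := hs'
    have h' := (Real.sqrt_inj (hpos s hs).le (hpos s' hs').le).1 h
    have : s ^ 2 = s' ^ 2 := by linarith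
    exact (pow_left_inj₀ hs0.le hs0'.le two_ne_zero).1 this

/-- Integration of a function of `|y|` and one coordinate. -/
lemma lintegral_axial {h : ℝ → ℝ → ℝ≥0∞} (hh : Measurable (Function.uncurry h)) :
    ∫⁻ y : Space 3, h ‖y‖ (y 0) = ENNReal.ofReal (2 * Real.pi) *
      ∫⁻ r in Set.Ioi (0 : ℝ), ENNReal.ofReal r * ∫⁻ z in Set.Ioo (-r) r, h r z := by
  have hnorm : ∀ y : Space 3, ‖y‖ = √(y 0 ^ 2 + (y 1 ^ 2 + y 2 ^ 2)) := by
    intro y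
    rw [EuclideanSpace.norm_eq, Fin.sum_univ_three]
    simp [add_assoc]
  have hz : ∀ z : ℝ, Measurable fun r => h r z := fun z => hh.comp (measurable_id.prodMk
    measurable_const)
  have hr : ∀ r : ℝ, Measurable fun z => h r z := fun r => hh.comp (measurable_const.prodMk
    measurable_id)
  have hF : Measurable fun q : ℝ × ℝ × ℝ => h (√(q.1 ^ 2 + (q.2.1 ^ 2 + q.2.2 ^ 2))) q.1 := by
    exact hh.comp ((by fun_prop : Measurable fun q : ℝ × ℝ × ℝ =>
      √(q.1 ^ 2 + (q.2.1 ^ 2 + q.2.2 ^ 2))).prodMk measurable_fst)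
  simp_rw [hnorm]
  rw [lintegral_space_three hF]
  -- On each plane at height `z`, polar coordinates and `r = √(z² + s²)` give an integral over `r >
  -- |z|`; exchanging the order then yields Archimedes' uniform law for `z` on each sphere.
  have hstep : ∀ z : ℝ, ∫⁻ p : ℝ × ℝ, h (√(z ^ 2 + (p.1 ^ 2 + p.2 ^ 2))) z =
      ENNReal.ofReal (2 * Real.pi) * ∫⁻ r, {q : ℝ × ℝ | |q.1| < q.2}.indicator
        (fun q => ENNReal.ofReal q.2 * h q.2 q.1) (z, r) := by
    intro z
    have hm : Measurable fun u : ℝ => h (√(z ^ 2 + u)) z :=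
      (hz z).comp (by fun_prop : Measurable fun u : ℝ => √(z ^ 2 + u))
    rw [lintegral_comp_sq_add_sq (f := fun u => h (√(z ^ 2 + u)) z) hm,
      lintegral_Ioi_sqrt (fun r => h r z) z, ← lintegral_indicator measurableSet_Ioi]
    rfl
  have hms : MeasurableSet {q : ℝ × ℝ | |q.1| < q.2} :=
    measurableSet_lt (by fun_prop) measurable_snd
  have hmi : Measurable ({q : ℝ × ℝ | |q.1| < q.2}.indicator
      (fun q => ENNReal.ofReal q.2 * h q.2 q.1)) := by
    refine Measurable.indicator ?_ hms
    exact (by fun_prop : Measurable fun q : ℝ × ℝ => ENNReal.ofReal q.2).mul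
      (hh.comp measurable_swap)
  simp_rw [hstep]
  rw [lintegral_const_mul _ hmi.lintegral_prod_right', lintegral_lintegral_swap
    (f := fun z r => {q : ℝ × ℝ | |q.1| < q.2}.indicator
      (fun q => ENNReal.ofReal q.2 * h q.2 q.1) (z, r)) hmi.aemeasurable]
  congr 1
  rw [← lintegral_indicator measurableSet_Ioi]
  refine lintegral_congr fun r => ?_
  by_cases hr0 : 0 < r
  · rw [Set.indicator_of_mem (show r ∈ Set.Ioi (0 : ℝ) from hr0), ← lintegral_const_mul _ (hr r),
      ← lintegral_indicator measurableSet_Ioo]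
    refine lintegral_congr fun z => ?_
    simp only [Set.indicator, Set.mem_ofPred_eq, Set.mem_Ioo, abs_lt]
  · rw [Set.indicator_of_notMem (show r ∉ Set.Ioi (0 : ℝ) from hr0)]
    refine (lintegral_congr fun z => ?_).trans lintegral_zero
    refine Set.indicator_of_notMem (fun hz => hr0 ?_) _
    exact (abs_nonneg z).trans_lt hz

lemma sq_add_sq_sub_pos {r t z : ℝ} (ht : 0 < t) (hrt : r ≠ t) (hz : z ≤ r) :
    0 < r ^ 2 + t ^ 2 - 2 * t * z := by
  have := sq_pos_of_ne_zero (sub_ne_zero.2 hrt)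
  nlinarith [mul_le_mul_of_nonneg_left hz ht.le]

/-- The integral equals `((r + t) - |r - t|) / t`; for `r = t` the integrand would be singular at
the endpoint `z = r`. -/
lemma integral_one_div_sqrt_le {r t : ℝ} (hr : 0 < r) (ht : 0 < t) (hrt : r ≠ t) :
    ∫ z in (-r)..r, 1 / √(r ^ 2 + t ^ 2 - 2 * t * z) ≤ 2 := by
  have huIcc : Set.uIcc (-r) r = Set.Icc (-r) r := Set.uIcc_of_le (by linarith)
  have hd : ∀ z ∈ Set.uIcc (-r) r, HasDerivAt (fun z => -(√(r ^ 2 + t ^ 2 - 2 * t * z) / t))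
      (1 / √(r ^ 2 + t ^ 2 - 2 * t * z)) z := by
    intro z hz
    rw [huIcc] at hz
    have hp := sq_add_sq_sub_pos ht hrt hz.2
    have h := (((((hasDerivAt_id z).const_mul (2 * t)).const_sub (r ^ 2 + t ^ 2)).sqrt
      hp.ne').div_const t).neg
    refine h.congr_deriv ?_
    have := Real.sqrt_pos.2 hp
    simp only [id]
    field_simp
  have hc : ContinuousOn (fun z => 1 / √(r ^ 2 + t ^ 2 - 2 * t * z)) (Set.uIcc (-r) r) := by
    refine ContinuousOn.div continuousOn_const (by fun_prop) fun z hz => ?_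
    rw [huIcc] at hz
    exact (Real.sqrt_pos.2 (sq_add_sq_sub_pos ht hrt hz.2)).ne'
  rw [intervalIntegral.integral_eq_sub_of_hasDerivAt hd hc.intervalIntegrable,
    show r ^ 2 + t ^ 2 - 2 * t * r = (r - t) ^ 2 by ring,
    show r ^ 2 + t ^ 2 - 2 * t * -r = (r + t) ^ 2 by ring, Real.sqrt_sq_eq_abs,
    Real.sqrt_sq (by positivity)]
  rw [neg_sub_neg, ← sub_div, div_le_iff₀ ht]
  linarith [le_abs_self (r - t)]

lemma lintegral_one_div_sqrt_le {r t : ℝ} (hr : 0 < r) (ht : 0 < t) (hrt : r ≠ t) :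
    ∫⁻ z in Set.Ioo (-r) r, ENNReal.ofReal (1 / √(r ^ 2 + t ^ 2 - 2 * t * z)) ≤
      ∫⁻ _z in Set.Ioo (-r) r, ENNReal.ofReal (1 / r) := by
  have hc : ContinuousOn (fun z => 1 / √(r ^ 2 + t ^ 2 - 2 * t * z)) (Set.Icc (-r) r) := by
    refine ContinuousOn.div continuousOn_const (by fun_prop) fun z hz => ?_
    exact (Real.sqrt_pos.2 (sq_add_sq_sub_pos ht hrt hz.2)).ne'
  have hi := (hc.integrableOn_compact (μ := volume) isCompact_Icc).mono_set Set.Ioo_subset_Icc_self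
  rw [← ofReal_integral_eq_lintegral_ofReal hi (Eventually.of_forall fun z => by positivity),
    ← integral_Ioc_eq_integral_Ioo, ← intervalIntegral.integral_of_le (by linarith),
    lintegral_const, Measure.restrict_apply_univ, Real.volume_Ioo,
    ← ENNReal.ofReal_mul (by positivity)]
  refine ENNReal.ofReal_le_ofReal ((integral_one_div_sqrt_le hr ht hrt).trans_eq ?_)
  field_simp
  ring

lemma lintegral_radial_potential_axis_le {g : ℝ → ℝ≥0∞} (hg : Measurable g) {t : ℝ} (ht : 0 < t) :
    ∫⁻ y : Space 3, g ‖y‖ * ENNReal.ofReal (1 / √(‖y‖ ^ 2 + t ^ 2 - 2 * t * y 0)) ≤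
      ∫⁻ y : Space 3, g ‖y‖ * ENNReal.ofReal (1 / ‖y‖) := by
  have m1 : Measurable (Function.uncurry fun r z : ℝ =>
      g r * ENNReal.ofReal (1 / √(r ^ 2 + t ^ 2 - 2 * t * z))) := by
    unfold Function.uncurry
    fun_prop
  have m2 : Measurable (Function.uncurry fun r _z : ℝ => g r * ENNReal.ofReal (1 / r)) := by
    unfold Function.uncurry
    fun_prop
  rw [lintegral_axial m1, lintegral_axial m2]
  refine mul_le_mul_right (lintegral_mono_ae ?_) _
  have hne : ∀ᵐ r ∂(volume.restrict (Set.Ioi (0 : ℝ))), r ≠ t :=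
    ae_restrict_of_ae (Measure.ae_ne volume t)
  filter_upwards [ae_restrict_mem measurableSet_Ioi, hne] with r hr hrt
  refine mul_le_mul_right ?_ _
  rw [lintegral_const_mul _ (by fun_prop), lintegral_const_mul _ (by fun_prop)]
  exact mul_le_mul_right (lintegral_one_div_sqrt_le hr ht hrt) _

/-- The potential of a spherically symmetric mass distribution is bounded by its value at the
origin. -/
lemma lintegral_radial_potential_le {g : ℝ → ℝ≥0∞} (hg : Measurable g) (x : Space 3) :
    ∫⁻ y : Space 3, g ‖y‖ * ENNReal.ofReal (1 / ‖x - y‖) ≤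
      ∫⁻ y : Space 3, g ‖y‖ * ENNReal.ofReal (1 / ‖y‖) := by
  rcases eq_or_ne x 0 with rfl | hx
  · simp
  have ht : 0 < ‖x‖ := norm_pos_iff.2 hx
  refine le_trans (le_of_eq ?_) (lintegral_radial_potential_axis_le hg ht)
  set e : Space 3 := EuclideanSpace.single 0 ‖x‖ with he
  have hen : ‖e‖ = ‖x‖ := by simp [he]
  -- The reflection exchanging `e` and `x` preserves volume and `‖y‖`, which moves `x` onto the
  -- first axis.
  set T : Space 3 ≃ₗᵢ[ℝ] Space 3 := (Submodule.span ℝ {e - x})ᗮ.reflection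
  have hT : T e = x := Submodule.reflection_sub hen
  rw [← T.measurePreserving.lintegral_comp_emb T.toMeasurableEquiv.measurableEmbedding]
  refine lintegral_congr fun y => ?_
  rw [← hT, ← map_sub, T.norm_map, T.norm_map]
  congr 3
  rw [← Real.sqrt_sq (norm_nonneg (e - y)), norm_sub_sq_real, hT, hen, he,
    EuclideanSpace.inner_single_left]
  congr 1
  simp
  ring

lemma ae_norm_of_ae_volumeIoiPow {P : ℝ → Prop}
    (h : ∀ᵐ r : Set.Ioi (0 : ℝ) ∂(Measure.volumeIoiPow (Module.finrank ℝ (Space 3) - 1)), P r) :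
    ∀ᵐ x : Space 3, P ‖x‖ := by
  have h1 : ∀ᵐ q ∂((volume : Measure (Space 3)).toSphere.prod
      (Measure.volumeIoiPow (Module.finrank ℝ (Space 3) - 1))), P q.2 :=
    Measure.quasiMeasurePreserving_snd.ae h
  have h2 := (volume : Measure (Space 3)).measurePreserving_homeomorphUnitSphereProd
    |>.quasiMeasurePreserving.ae h1
  have h3 := ((MeasurableEmbedding.subtype_coe
    (measurableSet_singleton (0 : Space 3)).compl).ae_map_iff (p := fun x => P ‖x‖)
    (μ := (volume : Measure (Space 3)).comap (↑))).2 (by simpa using h2)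
  rw [map_comap_subtype_coe (measurableSet_singleton (0 : Space 3)).compl,
    restrict_compl_singleton] at h3
  exact h3

/-- The given profile need not be measurable. By Fubini in polar coordinates, a measurable version
of `ρ` agrees with it almost everywhere along some ray, and the restriction to that ray is a
measurable profile. -/
lemma SphericallySymmetric.exists_measurable {ρ : Space 3 → ℝ} (h : SphericallySymmetric ρ)
    (hρ : AEStronglyMeasurable ρ) : ∃ g : ℝ → ℝ, Measurable g ∧ ∀ᵐ x, ρ x = g ‖x‖ := by
  obtain ⟨g, hg⟩ := h
  have h1 : ∀ᵐ x, hρ.mk ρ x = g ‖x‖ := by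
    filter_upwards [hg, hρ.ae_eq_mk] with x hx hx' using by rw [← hx', hx]
  have hmp := (volume : Measure (Space 3)).measurePreserving_homeomorphUnitSphereProd
  have hme := (homeomorphUnitSphereProd (Space 3)).measurableEmbedding
  have h2 : ∀ᵐ x : ({0}ᶜ : Set (Space 3)) ∂((volume : Measure (Space 3)).comap (↑)),
      hρ.mk ρ x = g ‖(x : Space 3)‖ := by
    have h3 : ∀ᵐ x ∂(((volume : Measure (Space 3)).comap
        ((↑) : ({0}ᶜ : Set (Space 3)) → Space 3)).map (↑)), hρ.mk ρ x = g ‖x‖ := by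
      rw [map_comap_subtype_coe (measurableSet_singleton (0 : Space 3)).compl]
      exact ae_restrict_of_ae h1
    exact ((MeasurableEmbedding.subtype_coe
      (measurableSet_singleton (0 : Space 3)).compl).ae_map_iff).1 h3
  have h3 : ∀ᵐ q ∂((volume : Measure (Space 3)).toSphere.prod
      (Measure.volumeIoiPow (Module.finrank ℝ (Space 3) - 1))),
      hρ.mk ρ ((q.2 : ℝ) • (q.1 : Space 3)) = g q.2 := by
    rw [← hmp.map_eq, hme.ae_map_iff]
    filter_upwards [h2] with x hx
    have hx0 : ‖(x : Space 3)‖ ≠ 0 := norm_ne_zero_iff.2 x.2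
    simpa [smul_smul, hx0] using hx
  have h4 := Measure.ae_ae_of_ae_prod h3
  have : NeZero (volume : Measure (Space 3)).toSphere := ⟨Measure.toSphere_ne_zero _⟩
  obtain ⟨ω, hω⟩ := h4.exists
  refine ⟨fun r => hρ.mk ρ (r • (ω : Space 3)), ?_, ?_⟩
  · exact hρ.stronglyMeasurable_mk.measurable.comp (by fun_prop)
  · have h5 := ae_norm_of_ae_volumeIoiPow (P := fun r => hρ.mk ρ (r • (ω : Space 3)) = g r) hω
    filter_upwards [h5, hg] with x hx hx' using by rw [hx, hx']

/-! ### Cutting a density at a sphere. -/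

lemma Admissible.indicator {p : ℝ} (hp : 0 < p) {ρ : Space 3 → ℝ} (h : Admissible p ρ)
    {S : Set (Space 3)} (hS : MeasurableSet S) : Admissible p (S.indicator ρ) where
  integrable := h.integrable.indicator hS
  nonneg := by
    filter_upwards [h.nonneg] with x hx
    by_cases hxS : x ∈ S <;> simp [hxS, hx]
  integrable_rpow := by
    refine (h.integrable_rpow.indicator hS).congr (Eventually.of_forall fun x => ?_)
    by_cases hxS : x ∈ S <;> simp [hxS, Real.zero_rpow hp.ne']

lemma integral_indicator_rpow {p : ℝ} (hp : 0 < p) (ρ : Space 3 → ℝ) {S : Set (Space 3)}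
    (hS : MeasurableSet S) : ∫ x, S.indicator ρ x ^ p = ∫ x in S, ρ x ^ p := by
  rw [← integral_indicator hS]
  refine integral_congr_ae (Eventually.of_forall fun x => ?_)
  by_cases hxS : x ∈ S <;> simp [hxS, Real.zero_rpow hp.ne']

lemma interaction_comm (ρ σ : Space 3 → ℝ) : interaction ρ σ = interaction σ ρ := by
  unfold interaction
  rw [Measure.volume_eq_prod, ← integral_prod_swap]
  refine integral_congr_ae (Eventually.of_forall fun z => ?_)
  simp only [interactionIntegrand, Prod.fst_swap, Prod.snd_swap, norm_sub_rev z.2 z.1]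
  ring

lemma interaction_eq_indicator_add {p : ℝ} (hp₁ : 6 / 5 < p) (hp₂ : p < 2) {ρ : Space 3 → ℝ}
    (hρ : Admissible p ρ) {S : Set (Space 3)} (hS : MeasurableSet S) :
    interaction ρ ρ = interaction (Sᶜ.indicator ρ) (Sᶜ.indicator ρ) +
      2 * interaction (Sᶜ.indicator ρ) (S.indicator ρ) +
      interaction (S.indicator ρ) (S.indicator ρ) := by
  have h1 := hρ.indicator (by linarith) hS.compl
  have h2 := hρ.indicator (by linarith) hS
  have i := @integrable_interactionIntegrand p hp₁ hp₂
  have h : ∀ z, interactionIntegrand ρ ρ z =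
      (interactionIntegrand (Sᶜ.indicator ρ) (Sᶜ.indicator ρ) z +
        interactionIntegrand (Sᶜ.indicator ρ) (S.indicator ρ) z) +
      (interactionIntegrand (S.indicator ρ) (Sᶜ.indicator ρ) z +
        interactionIntegrand (S.indicator ρ) (S.indicator ρ) z) := by
    intro z
    have hx : ∀ x, ρ x = Sᶜ.indicator ρ x + S.indicator ρ x := fun x =>
      (congrFun (Set.indicator_compl_add_self S ρ) x).symm
    simp only [interactionIntegrand]
    rw [hx z.1, hx z.2]
    ring
  have : interaction ρ ρ = (interaction (Sᶜ.indicator ρ) (Sᶜ.indicator ρ) +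
        interaction (Sᶜ.indicator ρ) (S.indicator ρ)) +
      (interaction (S.indicator ρ) (Sᶜ.indicator ρ) +
        interaction (S.indicator ρ) (S.indicator ρ)) := by
    unfold interaction
    simp_rw [h]
    rw [← integral_add (i h1 h1) (i h1 h2), ← integral_add (i h2 h1) (i h2 h2)]
    exact integral_add ((i h1 h1).add (i h1 h2)) ((i h2 h1).add (i h2 h2))
  rw [this, interaction_comm (S.indicator ρ) (Sᶜ.indicator ρ)]
  ring

lemma measurableSet_outer (R : ℝ) : MeasurableSet {x : Space 3 | R ≤ ‖x‖} :=
  measurableSet_le measurable_const measurable_norm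

/-- The potential of the part of a spherically symmetric density outside a ball. -/
lemma integral_outer_potential_le {ρ : Space 3 → ℝ} (hρ : Integrable ρ) (hρ₀ : ∀ᵐ x, 0 ≤ ρ x)
    (hs : SphericallySymmetric ρ) {R : ℝ} (hR : 0 < R) (x : Space 3) :
    ∫ y, {x : Space 3 | R ≤ ‖x‖}.indicator ρ y / ‖x - y‖ ≤ outerMass R ρ / R := by
  obtain ⟨g, hg, hρg⟩ := hs.exists_measurable hρ.1
  set S := {x : Space 3 | R ≤ ‖x‖} with hSdef
  have hS : MeasurableSet S := measurableSet_outer R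
  have hSρ : ∀ᵐ y, 0 ≤ S.indicator ρ y := by
    filter_upwards [hρ₀] with y hy
    by_cases h : y ∈ S <;> simp [h, hy]
  have hm : 0 ≤ outerMass R ρ := integral_nonneg_of_ae (ae_restrict_of_ae hρ₀)
  set G : ℝ → ℝ≥0∞ := (Set.Ici R).indicator fun r => ENNReal.ofReal (g r) with hG
  have hGm : Measurable G := (by fun_prop : Measurable fun r => ENNReal.ofReal (g r)).indicator
    measurableSet_Ici
  have hGρ : ∀ᵐ y : Space 3, ENNReal.ofReal (S.indicator ρ y) = G ‖y‖ := by
    filter_upwards [hρg] with y hy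
    by_cases h : R ≤ ‖y‖
    · simp [hG, hSdef, Set.indicator, h, hy]
    · simp [hG, hSdef, Set.indicator, h]
  have hmass : ∫⁻ y : Space 3, G ‖y‖ = ENNReal.ofReal (outerMass R ρ) := by
    rw [outerMass, ← integral_indicator hS,
      ofReal_integral_eq_lintegral_ofReal (hρ.indicator hS) hSρ]
    exact lintegral_congr_ae (hGρ.mono fun y hy => hy.symm)
  have hnn : 0 ≤ᵐ[volume] fun y => S.indicator ρ y / ‖x - y‖ := by
    filter_upwards [hSρ] with y hy using div_nonneg hy (norm_nonneg _)
  rw [integral_eq_lintegral_of_nonneg_ae hnn ((hρ.indicator hS).1.div₀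
    (by fun_prop : Measurable fun y : Space 3 => ‖x - y‖).aestronglyMeasurable)]
  refine ENNReal.toReal_le_of_le_ofReal (by positivity) ?_
  calc ∫⁻ y, ENNReal.ofReal (S.indicator ρ y / ‖x - y‖)
      = ∫⁻ y : Space 3, G ‖y‖ * ENNReal.ofReal (1 / ‖x - y‖) := by
        refine lintegral_congr_ae ?_
        filter_upwards [hGρ, hSρ] with y hy hy0
        rw [← hy, ← ENNReal.ofReal_mul hy0, mul_one_div]
    _ ≤ ∫⁻ y : Space 3, G ‖y‖ * ENNReal.ofReal (1 / ‖y‖) := lintegral_radial_potential_le hGm x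
    _ ≤ ∫⁻ y : Space 3, G ‖y‖ * ENNReal.ofReal (1 / R) := by
        refine lintegral_mono fun y => ?_
        by_cases h : R ≤ ‖y‖
        · gcongr
        · simp [hG, h]
    _ = ENNReal.ofReal (outerMass R ρ / R) := by
        rw [lintegral_mul_const _ (show Measurable fun y : Space 3 => G ‖y‖ from
          hGm.comp measurable_norm), hmass, ← ENNReal.ofReal_mul hm,
          mul_one_div]

lemma interaction_outer_le {p : ℝ} (hp₁ : 6 / 5 < p) (hp₂ : p < 2) {ρ σ : Space 3 → ℝ}
    (hρ : Admissible p ρ) (hσ : Admissible p σ) (hs : SphericallySymmetric ρ) {R : ℝ}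
    (hR : 0 < R) :
    interaction σ ({x : Space 3 | R ≤ ‖x‖}.indicator ρ) ≤ (∫ x, σ x) * (outerMass R ρ / R) := by
  have hi := integrable_interactionIntegrand hp₁ hp₂ hσ
    (hρ.indicator (by linarith) (measurableSet_outer R))
  unfold interaction
  rw [Measure.volume_eq_prod, integral_prod _ hi, ← integral_mul_const]
  refine integral_mono_ae hi.integral_prod_left (hσ.integrable.mul_const _) ?_
  filter_upwards [hσ.nonneg] with x hx
  simp only [interactionIntegrand, mul_div_assoc]
  rw [integral_const_mul]
  exact mul_le_mul_of_nonneg_left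
    (integral_outer_potential_le hρ.integrable hρ.nonneg hs hR x) hx

/-! ### The energy estimate and concentration. -/

section Concentration

variable {μ K₁₁ M J : ℝ}

/-- The kinetic part of the reduced energy. -/
def kineticEnergy (μ K₁₁ J : ℝ) (ρ : Space 3 → ℝ) : ℝ :=
  K₁₁ / J ^ (2 * (μ + 1) / 3) * (∫ x : Space 3, ρ x ^ densityExponent μ) ^ ((2 * μ + 3) / 3)

lemma interaction_le_sqrt (hμ₀ : 0 < μ) (hμ₁ : μ < 7 / 2) (hK : 0 < K₁₁) (hM : 0 < M)
    (hJ : 0 < J) {ρ : Space 3 → ℝ} (hρ : Admissible (densityExponent μ) ρ) :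
    interaction ρ ρ / 2 ≤ 2 * √(-reducedInf μ K₁₁ M J) *
      (((∫ x, ρ x) / M) ^ ((7 / 3 - 2 * μ / 3) / 2) * √(kineticEnergy μ K₁₁ J ρ)) := by
  have hm : 0 ≤ ∫ x, ρ x := integral_nonneg_of_ae hρ.nonneg
  -- Zero mass is separate because `interaction_sq_le` rescales the mass to `M`.
  rcases hm.eq_or_lt with h0 | hm
  · have hz : ρ =ᵐ[volume] 0 :=
      (integral_eq_zero_iff_of_nonneg_ae hρ.nonneg hρ.integrable).1 h0.symm
    have : interaction ρ ρ = 0 := by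
      refine integral_eq_zero_of_ae ?_
      filter_upwards [Measure.quasiMeasurePreserving_fst.ae hz] with z h1
      simp [interactionIntegrand, h1]
    rw [this, ← h0]
    simp only [zero_div]
    positivity
  · have h := interaction_sq_le hμ₀ hμ₁ hK hM hJ hρ rfl hm
    rw [← kineticEnergy] at h
    have hR := reducedInf_neg hμ₀ hμ₁ hK hM hJ
    have hA := hρ.integral_rpow_pos hm
    have hT : 0 ≤ kineticEnergy μ K₁₁ J ρ := by unfold kineticEnergy; positivity
    have hx : 0 ≤ (∫ x, ρ x) / M := by positivity
    refine le_of_sq_le_sq ?_ (by positivity)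
    refine h.trans_eq ?_
    rw [mul_pow, mul_pow, mul_pow, Real.sq_sqrt (by linarith), Real.sq_sqrt hT,
      ← Real.rpow_natCast (((∫ x, ρ x) / M) ^ ((7 / 3 - 2 * μ / 3) / 2)) 2, ← Real.rpow_mul hx]
    norm_num

/-- The mass, the kinetic energy and the interaction of the parts of a spherically symmetric
density inside and outside a ball. -/
lemma exists_splitting (hμ₀ : 0 < μ) (hμ₁ : μ < 7 / 2) (hK : 0 < K₁₁) (hM : 0 < M)
    (hJ : 0 < J) {ρ : Space 3 → ℝ} (hρ : ρ ∈ constraintSet μ M) (hs : SphericallySymmetric ρ)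
    {R : ℝ} (hR : 0 < R) :
    0 ≤ outerMass R ρ ∧ outerMass R ρ ≤ M ∧ 0 < kineticEnergy μ K₁₁ J ρ ∧
    ∃ y P₁ P₂ D : ℝ, 0 ≤ y ∧ y ≤ 1 ∧
      reducedEnergy μ K₁₁ J ρ = kineticEnergy μ K₁₁ J ρ - (P₁ + D + P₂) ∧
      P₁ ≤ 2 * √(-reducedInf μ K₁₁ M J) * √(kineticEnergy μ K₁₁ J ρ) *
        (((M - outerMass R ρ) / M) ^ ((7 / 3 - 2 * μ / 3) / 2) * y ^ ((2 * μ + 3) / 3 / 2)) ∧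
      P₂ ≤ 2 * √(-reducedInf μ K₁₁ M J) * √(kineticEnergy μ K₁₁ J ρ) *
        ((outerMass R ρ / M) ^ ((7 / 3 - 2 * μ / 3) / 2) * (1 - y) ^ ((2 * μ + 3) / 3 / 2)) ∧
      D ≤ outerMass R ρ * (M - outerMass R ρ) / R ∧ P₂ ≤ outerMass R ρ ^ 2 / (2 * R) := by
  have hp₁ := densityExponent_gt hμ₀ hμ₁
  have hp₂ := densityExponent_lt_two hμ₀
  have hp : 0 < densityExponent μ := by linarith
  obtain ⟨hρ, hm⟩ := (mem_constraintSet_iff hp).1 hρ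
  have hA := hρ.integral_rpow_pos (hm ▸ hM)
  have hc : 0 < K₁₁ / J ^ (2 * (μ + 1) / 3) := by positivity
  set S := {x : Space 3 | R ≤ ‖x‖} with hSdef
  have hS : MeasurableSet S := measurableSet_outer R
  have h1 := hρ.indicator hp hS.compl
  have h2 := hρ.indicator hp hS
  have hmass2 : ∫ x, S.indicator ρ x = outerMass R ρ := integral_indicator hS
  have hmass1 : ∫ x, Sᶜ.indicator ρ x = M - outerMass R ρ := by
    rw [integral_indicator hS.compl, ← hm, outerMass, ← integral_add_compl hS hρ.integrable]
    ring
  have hm0 : 0 ≤ outerMass R ρ := hmass2 ▸ integral_nonneg_of_ae h2.nonneg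
  have hm1 : 0 ≤ M - outerMass R ρ := hmass1 ▸ integral_nonneg_of_ae h1.nonneg
  have hpow : ∀ {σ : Space 3 → ℝ}, Admissible (densityExponent μ) σ →
      0 ≤ ∫ x, σ x ^ densityExponent μ := fun hσ => integral_nonneg_of_ae (by
    filter_upwards [hσ.nonneg] with x hx using Real.rpow_nonneg hx _)
  have hB1 := hpow h1
  have hB2 := hpow h2
  have hsum : (∫ x, Sᶜ.indicator ρ x ^ densityExponent μ) +
      (∫ x, S.indicator ρ x ^ densityExponent μ) = ∫ x, ρ x ^ densityExponent μ := by
    rw [integral_indicator_rpow hp _ hS, integral_indicator_rpow hp _ hS.compl, add_comm]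
    exact integral_add_compl hS hρ.integrable_rpow
  have hT : 0 < kineticEnergy μ K₁₁ J ρ := by unfold kineticEnergy; positivity
  have hkin : ∀ (σ : Space 3 → ℝ) (u : ℝ), 0 ≤ u →
      ∫ x, σ x ^ densityExponent μ = u * ∫ x, ρ x ^ densityExponent μ →
      √(kineticEnergy μ K₁₁ J σ) = u ^ ((2 * μ + 3) / 3 / 2) * √(kineticEnergy μ K₁₁ J ρ) := by
    intro σ u hu h
    have hsq : √(u ^ ((2 * μ + 3) / 3)) = u ^ ((2 * μ + 3) / 3 / 2) := by
      rw [Real.sqrt_eq_rpow, ← Real.rpow_mul hu]; congr 1; ring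
    rw [kineticEnergy, h, Real.mul_rpow hu hA.le, ← hsq, ← Real.sqrt_mul (by positivity),
      kineticEnergy]
    congr 1; ring
  set A := ∫ x, ρ x ^ densityExponent μ
  have b1 := interaction_le_sqrt hμ₀ hμ₁ hK hM hJ h1
  have b2 := interaction_le_sqrt hμ₀ hμ₁ hK hM hJ h2
  rw [hmass1, hkin _ ((∫ x, Sᶜ.indicator ρ x ^ densityExponent μ) / A) (by positivity)
    (by field_simp)] at b1
  have hy : 1 - (∫ x, Sᶜ.indicator ρ x ^ densityExponent μ) / A =
      (∫ x, S.indicator ρ x ^ densityExponent μ) / A := by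
    rw [← hsum]; rw [← hsum] at hA; field_simp; ring
  rw [hmass2, hkin _ ((∫ x, S.indicator ρ x ^ densityExponent μ) / A) (by positivity)
    (by field_simp), ← hy] at b2
  have d1 := interaction_outer_le hp₁ hp₂ hρ h1 hs hR
  -- A second bound on the outer self-energy, used only when nearly all the mass is outside.
  have d2 := interaction_outer_le hp₁ hp₂ hρ h2 hs hR
  rw [hmass1] at d1
  rw [hmass2] at d2
  refine ⟨hm0, by linarith, hT, (∫ x, Sᶜ.indicator ρ x ^ densityExponent μ) / A,
    interaction (Sᶜ.indicator ρ) (Sᶜ.indicator ρ) / 2, interaction (S.indicator ρ) (S.indicator ρ) / 2,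
    interaction (Sᶜ.indicator ρ) (S.indicator ρ), by positivity, ?_, ?_, ?_, ?_, ?_, ?_⟩
  · rw [div_le_one hA]; linarith
  · rw [reducedEnergy_eq, interaction_eq_indicator_add hp₁ hp₂ hρ hS, kineticEnergy]
    ring
  · refine b1.trans_eq ?_; ring
  · refine b2.trans_eq ?_; ring
  · refine d1.trans_eq ?_; ring
  · calc _ ≤ outerMass R ρ * (outerMass R ρ / R) / 2 := by linarith
      _ = _ := by field_simp

lemma one_div_criticalRadius :
    1 / criticalRadius μ K₁₁ M J =
      (7 / 3 - 2 * μ / 3) * (-reducedInf μ K₁₁ M J) / M ^ 2 := by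
  unfold criticalRadius
  rw [one_div_div]; ring

lemma reducedEnergy_ge (hμ₀ : 0 < μ) (hμ₁ : μ < 7 / 2) (hK : 0 < K₁₁) (hM : 0 < M)
    (hJ : 0 < J) {ρ : Space 3 → ℝ} (hρ : ρ ∈ constraintSet μ M) (hs : SphericallySymmetric ρ)
    {R : ℝ} (hR : 0 < R) :
    reducedInf μ K₁₁ M J + outerMass R ρ * (M - outerMass R ρ) *
      (1 / criticalRadius μ K₁₁ M J - 1 / R) ≤ reducedEnergy μ K₁₁ J ρ := by
  obtain ⟨hm0, hm1, hT, y, P₁, P₂, D, hy0, hy1, hE, h1, h2, hD, -⟩ :=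
    exists_splitting hμ₀ hμ₁ hK hM hJ hρ hs hR
  have hneg := reducedInf_neg hμ₀ hμ₁ hK hM hJ
  have hS := sq_split_le (x := (M - outerMass R ρ) / M) (y := y) (k := 7 / 3 - 2 * μ / 3)
    (q := (2 * μ + 3) / 3) (div_nonneg (by linarith) hM.le)
    ((div_le_one hM).2 (by linarith)) hy0 hy1 (by linarith) (by linarith) (by ring)
  have hx : 1 - (M - outerMass R ρ) / M = outerMass R ρ / M := by field_simp; ring
  rw [hx] at hS
  rw [one_div_criticalRadius, hE]
  set m := outerMass R ρ
  set T := kineticEnergy μ K₁₁ J ρ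
  set r := -reducedInf μ K₁₁ M J with hr
  set k := 7 / 3 - 2 * μ / 3
  set s := ((M - m) / M) ^ (k / 2) * y ^ ((2 * μ + 3) / 3 / 2) +
    (m / M) ^ (k / 2) * (1 - y) ^ ((2 * μ + 3) / 3 / 2)
  have hr0 : 0 < r := by linarith
  have hsum : P₁ + P₂ ≤ 2 * √r * √T * s := by
    refine (add_le_add h1 h2).trans_eq ?_
    ring
  have hsq := sq_nonneg (√T - √r * s)
  have eT := Real.sq_sqrt hT.le
  have er := Real.sq_sqrt hr0.le
  -- The minimum over `√T` is attained at `√T = √r * s`.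
  have hquad : -(r * s ^ 2) ≤ T - 2 * √r * √T * s := by
    have : (√T - √r * s) ^ 2 = T - 2 * √r * √T * s + r * s ^ 2 := by
      rw [← eT, ← er]; simp only [Real.sqrt_sq (Real.sqrt_nonneg _)]; ring
    linarith
  have hrs := mul_le_mul_of_nonneg_left hS hr0.le
  have e1 : r * (1 - k * ((M - m) / M * (m / M))) = r - m * (M - m) * (k * r / M ^ 2) := by
    field_simp
  have e2 : m * (M - m) * (k * r / M ^ 2 - 1 / R) =
      m * (M - m) * (k * r / M ^ 2) - m * (M - m) / R := by ring
  rw [e2]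
  rw [e1] at hrs
  linarith

/-- The scaling inequality at `m = M` gives `E ≥ T - 2 √r √T`, with `r = -reducedInf`. Hence almost
minimal energy forces `T` close to `r`. -/
lemma sq_sqrt_sub_sqrt_le (hμ₀ : 0 < μ) (hμ₁ : μ < 7 / 2) (hK : 0 < K₁₁) (hM : 0 < M)
    (hJ : 0 < J) {ρ : Space 3 → ℝ} (hρ : ρ ∈ constraintSet μ M) :
    (√(kineticEnergy μ K₁₁ J ρ) - √(-reducedInf μ K₁₁ M J)) ^ 2 ≤
      reducedEnergy μ K₁₁ J ρ - reducedInf μ K₁₁ M J := by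
  have hp := densityExponent_gt hμ₀ hμ₁
  obtain ⟨hρ, hm⟩ := (mem_constraintSet_iff (by linarith)).1 hρ
  have hneg := reducedInf_neg hμ₀ hμ₁ hK hM hJ
  have hA := hρ.integral_rpow_pos (hm ▸ hM)
  have h := interaction_le_sqrt hμ₀ hμ₁ hK hM hJ hρ
  have hT : 0 < kineticEnergy μ K₁₁ J ρ := by unfold kineticEnergy; positivity
  rw [hm, div_self hM.ne', Real.one_rpow] at h
  rw [reducedEnergy_eq, ← kineticEnergy, sub_sq, Real.sq_sqrt hT.le, Real.sq_sqrt (by linarith)]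
  linarith

/-- A spherically symmetric density of almost minimal energy keeps a fixed fraction of its mass
inside every ball of radius larger than the critical one. -/
lemma inner_mass_ge (hμ₀ : 0 < μ) (hμ₁ : μ < 7 / 2) (hK : 0 < K₁₁) (hM : 0 < M)
    (hJ : 0 < J) {ρ : Space 3 → ℝ} (hρ : ρ ∈ constraintSet μ M) (hs : SphericallySymmetric ρ)
    {R : ℝ} (hR₀ : 0 < R) (hR : 1 / R ≤ 1 / criticalRadius μ K₁₁ M J)
    (hE : reducedEnergy μ K₁₁ J ρ - reducedInf μ K₁₁ M J ≤ -reducedInf μ K₁₁ M J / 100) :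
    M * (1 / 3 : ℝ) ^ (2 / (7 / 3 - 2 * μ / 3)) ≤ M - outerMass R ρ := by
  obtain ⟨hm0, hm1, hT, y, P₁, P₂, D, hy0, hy1, hEq, h1, -, hD, h2⟩ :=
    exists_splitting hμ₀ hμ₁ hK hM hJ hρ hs hR₀
  have hneg := reducedInf_neg hμ₀ hμ₁ hK hM hJ
  have hd := (sq_sqrt_sub_sqrt_le hμ₀ hμ₁ hK hM hJ hρ).trans hE
  rw [one_div_criticalRadius] at hR
  rw [hEq] at hE
  set m := outerMass R ρ
  set T := kineticEnergy μ K₁₁ J ρ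
  set k := 7 / 3 - 2 * μ / 3 with hk
  have hk0 : 0 < k := by linarith
  have hk1 : k < 7 / 3 := by linarith
  set r := √(-reducedInf μ K₁₁ M J) with hr
  set a := √T
  have hr0 : 0 < r := Real.sqrt_pos.2 (by linarith)
  have er : -reducedInf μ K₁₁ M J = r ^ 2 := (Real.sq_sqrt (by linarith)).symm
  have eT : T = a ^ 2 := (Real.sq_sqrt hT.le).symm
  have ha0 : 0 < a := Real.sqrt_pos.2 hT
  have hx0 : 0 ≤ (M - m) / M := div_nonneg (by linarith) hM.le
  -- The threshold makes the inner mass factor at most `1/3`.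
  by_contra! hlt
  have hxlt : (M - m) / M < (1 / 3 : ℝ) ^ (2 / k) := by
    rw [div_lt_iff₀ hM]; linarith
  have hX : ((M - m) / M) ^ (k / 2) ≤ 1 / 3 := by
    calc ((M - m) / M) ^ (k / 2) ≤ ((1 / 3 : ℝ) ^ (2 / k)) ^ (k / 2) := by gcongr
      _ = 1 / 3 := by
        rw [← Real.rpow_mul (by norm_num), show 2 / k * (k / 2) = 1 by field_simp, Real.rpow_one]
  have hXY : ((M - m) / M) ^ (k / 2) * y ^ ((2 * μ + 3) / 3 / 2) ≤ 1 / 3 := by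
    have hy := Real.rpow_le_one hy0 hy1 (z := (2 * μ + 3) / 3 / 2) (by positivity)
    calc _ ≤ 1 / 3 * (1 : ℝ) := by gcongr
      _ = _ := by ring
  have hP1 : P₁ ≤ 2 / 3 * (r * a) := by
    refine h1.trans ?_
    calc _ ≤ 2 * r * a * (1 / 3) := by gcongr
      _ = _ := by ring
  have hP2 : D + P₂ ≤ k * r ^ 2 / 2 := by
    have hle : D + P₂ ≤ M ^ 2 / 2 * (1 / R) := by
      have : m * (M - m) / R + m ^ 2 / (2 * R) = (M ^ 2 - (M - m) ^ 2) / 2 * (1 / R) := by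
        field_simp; ring
      have h3 : (M ^ 2 - (M - m) ^ 2) / 2 * (1 / R) ≤ M ^ 2 / 2 * (1 / R) := by
        gcongr
        nlinarith [sq_nonneg (M - m)]
      linarith
    refine hle.trans ?_
    rw [er] at hR
    calc _ ≤ M ^ 2 / 2 * (k * r ^ 2 / M ^ 2) := by gcongr
      _ = _ := by field_simp
  rw [er] at hE hd
  -- Here `r² = -reducedInf` and `a² = T`, and the tolerance `1/100` gives `a ≥ 9r/10`. Then `a² -
  -- 2ra/3 - 7r²/6 + r²` is at least `(0.81 - 0.6 - 1/6) r² > r²/100`, contradicting `hE2`.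
  have hd2 : -(r / 10) ≤ a - r :=
    (abs_le.1 (abs_le_of_sq_le_sq (show (a - r) ^ 2 ≤ (r / 10) ^ 2 by linarith) (by positivity))).1
  have hE2 : a ^ 2 - 2 / 3 * (r * a) - k * r ^ 2 / 2 + r ^ 2 ≤ r ^ 2 / 100 := by linarith
  have hkr : k * r ^ 2 ≤ 7 / 3 * r ^ 2 := by gcongr
  nlinarith [mul_pos hr0 hr0, sq_nonneg (a - r),
    mul_nonneg hr0.le (by linarith : 0 ≤ a - r + r / 10)]

lemma tendsto_outerMass (hμ₀ : 0 < μ) (hμ₁ : μ < 7 / 2) (hK : 0 < K₁₁) (hM : 0 < M)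
    (hJ : 0 < J) {R : ℝ} (hR : criticalRadius μ K₁₁ M J < R) {ρ : ℕ → Space 3 → ℝ}
    (hρ : IsMinimizingSequence μ K₁₁ M J ρ) (hs : ∀ n, SphericallySymmetric (ρ n)) :
    Tendsto (fun n => outerMass R (ρ n)) atTop (𝓝 0) := by
  have hneg := reducedInf_neg hμ₀ hμ₁ hK hM hJ
  have hk : 0 < 7 / 3 - 2 * μ / 3 := by linarith
  have hR₀ : 0 < criticalRadius μ K₁₁ M J := by
    unfold criticalRadius
    have := mul_pos hk (neg_pos.2 hneg)
    rw [mul_neg] at this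
    positivity
  have hRpos : 0 < R := hR₀.trans hR
  have hγ : 0 < 1 / criticalRadius μ K₁₁ M J - 1 / R :=
    sub_pos.2 (one_div_lt_one_div_of_lt hR₀ hR)
  set γ := 1 / criticalRadius μ K₁₁ M J - 1 / R with hγdef
  set c := M * (1 / 3 : ℝ) ^ (2 / (7 / 3 - 2 * μ / 3))
  have hc : 0 < c := by positivity
  have hlim : Tendsto (fun n => (reducedEnergy μ K₁₁ J (ρ n) - reducedInf μ K₁₁ M J) / (c * γ))
      atTop (𝓝 0) := by
    have := (hρ.2.sub_const (reducedInf μ K₁₁ M J)).div_const (c * γ)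
    simpa using this
  have hev : ∀ᶠ n in atTop, reducedEnergy μ K₁₁ J (ρ n) <
      reducedInf μ K₁₁ M J + -reducedInf μ K₁₁ M J / 100 :=
    hρ.2.eventually_lt_const (by linarith)
  refine tendsto_of_tendsto_of_tendsto_of_le_of_le' tendsto_const_nhds hlim
    (Eventually.of_forall fun n => ?_) ?_
  · exact (exists_splitting hμ₀ hμ₁ hK hM hJ (hρ.1 n) (hs n) hRpos).1
  · filter_upwards [hev] with n hn
    have hm := (exists_splitting hμ₀ hμ₁ hK hM hJ (hρ.1 n) (hs n) hRpos).1
    have hin := inner_mass_ge hμ₀ hμ₁ hK hM hJ (hρ.1 n) (hs n) hRpos (by linarith) (by linarith)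
    have hge := reducedEnergy_ge hμ₀ hμ₁ hK hM hJ (hρ.1 n) (hs n) hRpos
    rw [← hγdef] at hge
    rw [le_div_iff₀ (by positivity)]
    -- The lower bound `c` on the inner mass makes the energy estimate linear in the outer mass.
    calc outerMass R (ρ n) * (c * γ) = outerMass R (ρ n) * c * γ := by ring
      _ ≤ outerMass R (ρ n) * (M - outerMass R (ρ n)) * γ := by gcongr
      _ ≤ _ := by linarith

end Concentration

end StellarDynamics

end

theorem mainTheorem2 (μ K₁₁ M J : ℝ) (hμ₀ : 0 < μ) (hμ₁ : μ < 7 / 2)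
    (hK : 0 < K₁₁) (hM : 0 < M) (hJ : 0 < J) :
    -- the energy and the radius `R₀` are well defined
    (∀ ρ ∈ StellarDynamics.constraintSet μ M,
      MeasureTheory.Integrable
        (fun z : StellarDynamics.Space 3 × StellarDynamics.Space 3 =>
          ρ z.1 * ρ z.2 / ‖z.1 - z.2‖)) ∧
    BddBelow (StellarDynamics.reducedEnergy μ K₁₁ J '' StellarDynamics.constraintSet μ M) ∧
    StellarDynamics.reducedInf μ K₁₁ M J < 0 ∧
    -- the energy estimate
    (∀ ρ ∈ StellarDynamics.constraintSet μ M, StellarDynamics.SphericallySymmetric ρ →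
      ∀ R' m : ℝ, 0 < R' → m = StellarDynamics.outerMass R' ρ →
        StellarDynamics.reducedEnergy μ K₁₁ J ρ ≥
          StellarDynamics.reducedInf μ K₁₁ M J +
            m * (M - m) * (1 / StellarDynamics.criticalRadius μ K₁₁ M J - 1 / R')) ∧
    -- concentration of spherically symmetric minimizing sequences
    (∀ R' : ℝ, StellarDynamics.criticalRadius μ K₁₁ M J < R' →
      ∀ ρ : ℕ → StellarDynamics.Space 3 → ℝ,
        StellarDynamics.IsMinimizingSequence μ K₁₁ M J ρ →
        (∀ n, StellarDynamics.SphericallySymmetric (ρ n)) →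
        Filter.Tendsto (fun n => StellarDynamics.outerMass R' (ρ n)) Filter.atTop
          (nhds 0)) := by
  have hp₁ := StellarDynamics.densityExponent_gt hμ₀ hμ₁
  have hp₂ := StellarDynamics.densityExponent_lt_two hμ₀
  refine ⟨fun ρ hρ => ?_, StellarDynamics.bddBelow_reducedEnergy hμ₀ hμ₁ hK hM hJ,
    StellarDynamics.reducedInf_neg hμ₀ hμ₁ hK hM hJ, ?_, ?_⟩
  · have h := ((StellarDynamics.mem_constraintSet_iff (by linarith)).1 hρ).1
    exact StellarDynamics.integrable_interactionIntegrand hp₁ hp₂ h h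
  · rintro ρ hρ hs R' m hR' rfl
    exact StellarDynamics.reducedEnergy_ge hμ₀ hμ₁ hK hM hJ hρ hs hR'
  · intro R' hR' ρ hρ hs
    exact StellarDynamics.tendsto_outerMass hμ₀ hμ₁ hK hM hJ hR' hρ hs
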